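/- Let $\mathrm{Cl}(\mathbb R^m)$ be the real Clifford algebra with $v^2=-\langle v,v\rangle$, and let $\mathrm{Spin}(m)\subset\mathrm{Cl}(\mathbb R^m)$ be the compact spin group. Let $\mathrm{SU}(4)\subset M_4(\mathbb C)$ be the special unitary group and $\mathrm{Sp}(2)=\{A\in M_2(\mathbb H): A^\dagger A=AA^\dagger=1\}$ the compact symplectic group. Let vectors of $\mathbb R^{2n}$ act on $\Lambda^*\mathbb C^n$ by $v\mapsto w_v\wedge\cdot-\iota_{\overline{w_v}}$ with $(w_v)_r=v_{2r-1}-i\,v_{2r}$, where $\iota_{\overline w}$ is contraction with the functional $u\mapsto\sum_r\overline{w_r}u_r$; let the additional basis vector $e_{2n+1}$ of $\mathbb R^{2n+1}$ act by $i$ times the parity operator (that is, by $+i$ on $\Lambda^{\mathrm{even}}$ and by $-i$ on $\Lambda^{\mathrm{odd}}$). These actions extend to the Clifford algebras. The half-spin representation $\Delta^+$ of $\mathrm{Spin}(2n)$ is its action on $\Lambda^{\mathrm{even}}\mathbb C^n$ (on which $e_1\cdots e_{2n}$ acts as $i^n$), and the spin representation $\Delta$ of $\mathrm{Spin}(2n+1)$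 is its action on $\Lambda^*\mathbb C^n$. Then $\mathrm{Spin}(6)$, $\mathrm{SU}(4)$, $\mathrm{Spin}(5)$ and $\mathrm{Sp}(2)$ are Lie groups, with the smooth structure of embedded submanifolds of $\mathrm{Cl}(\mathbb R^6)$, $M_4(\mathbb C)$, $\mathrm{Cl}(\mathbb R^5)$ and $M_2(\mathbb H)$ respectively, and the spin representations give isomorphisms of Lie groups (group isomorphisms that are smooth with smooth inverse) $\mathrm{Spin}(6)\cong\mathrm{SU}(4)$ and $\mathrm{Spin}(5)\cong\mathrm{Sp}(2)$, in the following sense. 1. There are a complex linear isomorphism $T:\Delta^+\to\mathbb C^4$ and an isomorphism of Lie groups $f:\mathrm{Spin}(6)\to\mathrm{SU}(4)$ such that $T(\Delta^+(g)s)=f(g)\,T(s)$ for all $g\in\mathrm{Spin}(6)$ and $s\in\Delta^+$. 2. There are an additive isomorphism $T:\Delta\to\mathbb H^2$ with $T(zs)=T(s)z$ for all $z\in\mathbb C\subset\mathbb H$ and $s\in\Delta$ (so $T$ is complex linear for the right complex structure of $\mathbb H^2$), and an isomorphism of Lie groups $f:\mathrm{Spin}(5)\to\mathrm{Sp}(2)$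 such that $T(\Delta(g)s)=f(g)\,T(s)$ for all $g\in\mathrm{Spin}(5)$ and $s\in\Delta$. -/

import Mathlib

open scoped Manifold ContDiff Quaternion

noncomputable section

namespace SpinGroups

/-! ### The groups -/

/-- The quadratic form `v ↦ -⟨v, v⟩` on `ℝ^m`. -/
abbrev negForm (m : ℕ) : QuadraticForm ℝ (Fin m → ℝ) :=
  QuadraticMap.weightedSumSquares ℝ (fun _ : Fin m => (-1 : ℝ))

/-- The compact group `Spin(m)`, inside the Clifford algebra of `ℝ^m` with `v² = -⟨v, v⟩`. -/
abbrev Spin (m : ℕ) : Submonoid (CliffordAlgebra (negForm m)) :=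
  spinGroup (negForm m)

/-- The special unitary group `SU(n)`. -/
abbrev SU (n : ℕ) : Submonoid (Matrix (Fin n) (Fin n) ℂ) :=
  Matrix.specialUnitaryGroup (Fin n) ℂ

/-- The compact symplectic group `Sp(n)`: the quaternionic `n × n` matrices `A` with
`A† A = A A† = 1`, where `A†` is the conjugate transpose. -/
abbrev Sp (n : ℕ) : Submonoid (Matrix (Fin n) (Fin n) ℍ) :=
  unitary (Matrix (Fin n) (Fin n) ℍ)

/-! ### The spinor module: the exterior algebra `Λ^* ℂ^n` -/

/-- The exterior algebra `Λ^* ℂ^n`. -/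
abbrev Spinors (n : ℕ) : Type := ExteriorAlgebra ℂ (Fin n → ℂ)

/-- The even part `Λ^even ℂ^n` of the exterior algebra. -/
abbrev evenSpinors (n : ℕ) : Submodule ℂ (Spinors n) :=
  CliffordAlgebra.evenOdd (0 : QuadraticForm ℂ (Fin n → ℂ)) 0

/-- The odd part `Λ^odd ℂ^n` of the exterior algebra. -/
abbrev oddSpinors (n : ℕ) : Submodule ℂ (Spinors n) :=
  CliffordAlgebra.evenOdd (0 : QuadraticForm ℂ (Fin n → ℂ)) 1

/-- The linear functional `u ↦ ∑ r, conj (w r) * u r` on `ℂ^n`. -/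
def hermDual {n : ℕ} (w : Fin n → ℂ) : Module.Dual ℂ (Fin n → ℂ) :=
  ∑ r, (starRingEnd ℂ (w r)) • LinearMap.proj r

theorem hermDual_apply {n : ℕ} (w u : Fin n → ℂ) :
    hermDual w u = ∑ r, starRingEnd ℂ (w r) * u r := by
  simp [hermDual, LinearMap.sum_apply]

/-- The creation operator `ξ ↦ w ∧ ξ`. -/
def creation {n : ℕ} (w : Fin n → ℂ) : Module.End ℂ (Spinors n) :=
  LinearMap.mulLeft ℂ (ExteriorAlgebra.ι ℂ w)

/-- The annihilation operator: contraction with the functional `⟨w, ·⟩`. -/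
def annihilation {n : ℕ} (w : Fin n → ℂ) : Module.End ℂ (Spinors n) :=
  CliffordAlgebra.contractLeft (Q := (0 : QuadraticForm ℂ (Fin n → ℂ))) (hermDual w)

/-- The parity operator: `+1` on `Λ^even`, `-1` on `Λ^odd`. -/
def parity (n : ℕ) : Module.End ℂ (Spinors n) :=
  (CliffordAlgebra.involute (Q := (0 : QuadraticForm ℂ (Fin n → ℂ)))).toLinearMap

/-- The identification `ℝ^{2n} ≅ ℂ^n`, `v ↦ (v_{2r-1} - i v_{2r})_r` (coordinates numbered from
one). With this choice `e_{2r-1} e_{2r}` acts on spinors as `+i` where the `r`-th state is empty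
and as `-i` where it is occupied. -/
def complexify (n : ℕ) : (Fin (2 * n) → ℝ) →ₗ[ℝ] (Fin n → ℂ) where
  toFun v r := (v ⟨2 * r, by omega⟩ : ℂ) - Complex.I * (v ⟨2 * r + 1, by omega⟩ : ℂ)
  map_add' v w := by
    funext r
    simp only [Pi.add_apply, Complex.ofReal_add]
    ring
  map_smul' t v := by
    funext r
    simp only [Pi.smul_apply, smul_eq_mul, Complex.ofReal_mul, RingHom.id_apply,
      Complex.real_smul]
    ring

theorem hermDual_add {n : ℕ} (w w' : Fin n → ℂ) :
    hermDual (w + w') = hermDual w + hermDual w' := by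
  ext u
  simp [hermDual_apply, add_mul, Finset.sum_add_distrib]

theorem hermDual_real_smul {n : ℕ} (t : ℝ) (w : Fin n → ℂ) :
    hermDual (t • w) = (t : ℂ) • hermDual w := by
  ext u
  simp [hermDual_apply, Finset.mul_sum, mul_assoc]

theorem real_smul_eq {M : Type*} [AddCommGroup M] [Module ℂ M] [Module ℝ M]
    [IsScalarTower ℝ ℂ M] (t : ℝ) (x : M) : t • x = (t : ℂ) • x :=
  (IsScalarTower.algebraMap_smul ℂ t x).symm

/-- Clifford multiplication by vectors of `ℝ^{2n}` on `Λ^* ℂ^n`. -/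
def vectorAction (n : ℕ) : (Fin (2 * n) → ℝ) →ₗ[ℝ] Module.End ℂ (Spinors n) where
  toFun v := creation (complexify n v) - annihilation (complexify n v)
  map_add' v w := by
    refine LinearMap.ext fun x => ?_
    simp only [creation, annihilation, hermDual_add, map_add, LinearMap.sub_apply,
      LinearMap.add_apply, LinearMap.mulLeft_apply, add_mul]
    abel
  map_smul' t v := by
    refine LinearMap.ext fun x => ?_
    have h : (t • complexify n v) = (t : ℂ) • complexify n v := by
      funext r
      simp
    simp only [creation, annihilation, map_smul, LinearMap.sub_apply, LinearMap.smul_apply,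
      LinearMap.mulLeft_apply, RingHom.id_apply]
    rw [hermDual_real_smul, h, real_smul_eq, map_smul, map_smul, smul_sub, smul_mul_assoc,
      LinearMap.smul_apply]

theorem vectorAction_apply (n : ℕ) (v : Fin (2 * n) → ℝ) (x : Spinors n) :
    vectorAction n v x = ExteriorAlgebra.ι ℂ (complexify n v) * x -
      CliffordAlgebra.contractLeft (Q := (0 : QuadraticForm ℂ (Fin n → ℂ)))
        (hermDual (complexify n v)) x :=
  rfl

theorem hermDual_complexify_self (n : ℕ) (v : Fin (2 * n) → ℝ) :
    hermDual (complexify n v) (complexify n v) = -((negForm (2 * n) v : ℝ) : ℂ) := by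
  have key : ∀ f : Fin (2 * n) → ℝ, ∑ i, f i =
      ∑ r : Fin n, (f ⟨2 * r, by omega⟩ + f ⟨2 * r + 1, by omega⟩) := by
    intro f
    have e := Fintype.sum_equiv (finProdFinEquiv (m := n) (n := 2))
      (fun p => f (Fin.cast (by ring) (finProdFinEquiv p))) (fun j => f (Fin.cast (by ring) j))
      (fun _ => rfl)
    have e' := Fintype.sum_equiv (finCongr (show n * 2 = 2 * n by ring))
      (fun j => f (Fin.cast (by ring) j)) f (fun _ => rfl)
    rw [← e', ← e, Fintype.sum_prod_type]
    refine Finset.sum_congr rfl fun r _ => ?_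
    rw [Fin.sum_univ_two]
    congr 2
    · ext
      simp [finProdFinEquiv]
    · ext
      simp [finProdFinEquiv]
      ring
  rw [hermDual_apply, QuadraticMap.weightedSumSquares_apply, key]
  push_cast
  rw [← Finset.sum_neg_distrib]
  refine Finset.sum_congr rfl fun r _ => ?_
  simp only [complexify, LinearMap.coe_mk, AddHom.coe_mk, map_sub, map_mul, Complex.conj_ofReal,
    Complex.conj_I, smul_eq_mul]
  push_cast
  ring_nf
  rw [Complex.I_sq]
  ring

theorem vectorAction_sq (n : ℕ) (v : Fin (2 * n) → ℝ) :
    vectorAction n v * vectorAction n v = algebraMap ℝ _ (negForm (2 * n) v) := by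
  refine LinearMap.ext fun x => ?_
  have h1 : ExteriorAlgebra.ι ℂ (complexify n v) * (ExteriorAlgebra.ι ℂ (complexify n v) * x)
      = 0 := by
    rw [← mul_assoc, ExteriorAlgebra.ι_sq_zero, zero_mul]
  have h2 := CliffordAlgebra.contractLeft_ι_mul (Q := (0 : QuadraticForm ℂ (Fin n → ℂ)))
    (hermDual (complexify n v)) (complexify n v) x
  have h3 := CliffordAlgebra.contractLeft_contractLeft
    (Q := (0 : QuadraticForm ℂ (Fin n → ℂ))) (hermDual (complexify n v)) x
  rw [Module.End.mul_apply, vectorAction_apply, vectorAction_apply, mul_sub, map_sub, h1, h3,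
    Module.algebraMap_end_apply, real_smul_eq]
  have h4 : ((negForm (2 * n) v : ℝ) : ℂ) = -hermDual (complexify n v) (complexify n v) := by
    rw [hermDual_complexify_self, neg_neg]
  rw [h4, neg_smul]
  have h5 : CliffordAlgebra.contractLeft (Q := (0 : QuadraticForm ℂ (Fin n → ℂ)))
      (hermDual (complexify n v)) (ExteriorAlgebra.ι ℂ (complexify n v) * x) = _ := h2
  rw [h5]
  change 0 - ExteriorAlgebra.ι ℂ (complexify n v) * _ - (_ - ExteriorAlgebra.ι ℂ _ * _ - 0) = _
  abel

theorem parity_parity (n : ℕ) (x : Spinors n) : parity n (parity n x) = x :=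
  CliffordAlgebra.involute_involute x

theorem parity_contractLeft {n : ℕ} (d : Module.Dual ℂ (Fin n → ℂ)) (x : Spinors n) :
    parity n (CliffordAlgebra.contractLeft (Q := (0 : QuadraticForm ℂ (Fin n → ℂ))) d x) =
      -CliffordAlgebra.contractLeft (Q := (0 : QuadraticForm ℂ (Fin n → ℂ))) d (parity n x) := by
  unfold parity
  induction x using CliffordAlgebra.left_induction with
  | algebraMap r => simp [CliffordAlgebra.contractLeft_algebraMap]
  | add x y hx hy => simp only [map_add, hx, hy, neg_add]
  | ι_mul x m hx =>
    simp only [AlgHom.toLinearMap_apply] at hx ⊢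
    rw [CliffordAlgebra.contractLeft_ι_mul, map_sub, map_smul, map_mul, map_mul,
      CliffordAlgebra.involute_ι, neg_mul, neg_mul, map_neg,
      CliffordAlgebra.contractLeft_ι_mul, hx, mul_neg, neg_neg, neg_neg]

theorem parity_vectorAction (n : ℕ) (v : Fin (2 * n) → ℝ) (x : Spinors n) :
    parity n (vectorAction n v x) = -vectorAction n v (parity n x) := by
  rw [vectorAction_apply, vectorAction_apply, map_sub, parity_contractLeft]
  have h : parity n (ExteriorAlgebra.ι ℂ (complexify n v) * x) =
      -(ExteriorAlgebra.ι ℂ (complexify n v) * parity n x) := by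
    have h0 : CliffordAlgebra.involute (Q := (0 : QuadraticForm ℂ (Fin n → ℂ)))
        (CliffordAlgebra.ι _ (complexify n v) * x) = _ := map_mul _ _ _
    rw [CliffordAlgebra.involute_ι, neg_mul] at h0
    exact h0
  rw [h]
  abel

theorem mem_evenSpinors_iff {n : ℕ} (x : Spinors n) : x ∈ evenSpinors n ↔ parity n x = x := by
  refine ⟨fun h => CliffordAlgebra.involute_eq_of_mem_even h, fun h => ?_⟩
  have hx : x ∈ evenSpinors n ⊔ oddSpinors n := by
    rw [(CliffordAlgebra.evenOdd_isCompl (0 : QuadraticForm ℂ (Fin n → ℂ))).sup_eq_top]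
    trivial
  obtain ⟨a, ha, b, hb, rfl⟩ := Submodule.mem_sup.1 hx
  have ha' : parity n a = a := CliffordAlgebra.involute_eq_of_mem_even ha
  have hb' : parity n b = -b := CliffordAlgebra.involute_eq_of_mem_odd hb
  rw [map_add, ha', hb', add_right_inj, neg_eq_iff_add_eq_zero, ← two_smul ℂ,
    smul_eq_zero_iff_right two_ne_zero] at h
  rw [h, add_zero]
  exact ha

/-! ### The spin representations -/

/-- The action of the Clifford algebra of `ℝ^{2n}` on `Λ^* ℂ^n`. -/
def cliffordAction (n : ℕ) :
    CliffordAlgebra (negForm (2 * n)) →ₐ[ℝ] Module.End ℂ (Spinors n) :=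
  CliffordAlgebra.lift (negForm (2 * n)) ⟨vectorAction n, vectorAction_sq n⟩

/-- Vectors of `ℝ^{2n+1}` act on `Λ^* ℂ^n`: the first `2n` coordinates as before, and the last
basis vector as `i` times the parity operator. -/
def oddVectorAction (n : ℕ) : (Fin (2 * n + 1) → ℝ) →ₗ[ℝ] Module.End ℂ (Spinors n) where
  toFun v := vectorAction n (fun j => v j.castSucc) +
    ((v (Fin.last (2 * n)) : ℂ) * Complex.I) • parity n
  map_add' v w := by
    have h : (fun j : Fin (2 * n) => (v + w) j.castSucc) =
        (fun j => v j.castSucc) + fun j => w j.castSucc := rfl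
    rw [h, map_add, Pi.add_apply, Complex.ofReal_add, add_mul, add_smul]
    abel
  map_smul' t v := by
    have h : (fun j : Fin (2 * n) => (t • v) j.castSucc) = t • fun j => v j.castSucc := rfl
    rw [h, map_smul, Pi.smul_apply, smul_eq_mul, Complex.ofReal_mul, RingHom.id_apply, smul_add,
      mul_assoc, mul_smul, real_smul_eq t (_ • parity n)]

theorem oddVectorAction_apply (n : ℕ) (v : Fin (2 * n + 1) → ℝ) (x : Spinors n) :
    oddVectorAction n v x = vectorAction n (fun j => v j.castSucc) x +
      ((v (Fin.last (2 * n)) : ℂ) * Complex.I) • parity n x :=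
  rfl

theorem oddVectorAction_sq (n : ℕ) (v : Fin (2 * n + 1) → ℝ) :
    oddVectorAction n v * oddVectorAction n v = algebraMap ℝ _ (negForm (2 * n + 1) v) := by
  refine LinearMap.ext fun x => ?_
  have h := LinearMap.congr_fun (vectorAction_sq n fun j => v j.castSucc) x
  rw [Module.End.mul_apply, Module.algebraMap_end_apply, real_smul_eq] at h
  have h2 : negForm (2 * n + 1) v = negForm (2 * n) (fun j => v j.castSucc) -
      v (Fin.last (2 * n)) * v (Fin.last (2 * n)) := by
    rw [QuadraticMap.weightedSumSquares_apply, QuadraticMap.weightedSumSquares_apply,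
      Fin.sum_univ_castSucc]
    simp only [smul_eq_mul]
    ring
  rw [Module.End.mul_apply, oddVectorAction_apply, oddVectorAction_apply, map_add, map_add, h,
    map_smul, map_smul, parity_parity, parity_vectorAction, Module.algebraMap_end_apply,
    real_smul_eq, h2, smul_add, smul_neg, smul_smul]
  have h3 : ((v (Fin.last (2 * n)) : ℂ) * Complex.I) * ((v (Fin.last (2 * n)) : ℂ) * Complex.I)
      = -((v (Fin.last (2 * n)) * v (Fin.last (2 * n)) : ℝ) : ℂ) := by
    push_cast
    ring_nf
    rw [Complex.I_sq]
    ring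
  rw [h3, Complex.ofReal_sub, sub_smul, neg_smul]
  abel

/-- The action of the Clifford algebra of `ℝ^{2n+1}` on `Λ^* ℂ^n`. -/
def oddCliffordAction (n : ℕ) :
    CliffordAlgebra (negForm (2 * n + 1)) →ₐ[ℝ] Module.End ℂ (Spinors n) :=
  CliffordAlgebra.lift (negForm (2 * n + 1)) ⟨oddVectorAction n, oddVectorAction_sq n⟩

/-- Even Clifford elements commute with the parity operator. -/
theorem parity_cliffordAction (n : ℕ) {a : CliffordAlgebra (negForm (2 * n))}
    (ha : a ∈ CliffordAlgebra.even (negForm (2 * n))) (x : Spinors n) :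
    parity n (cliffordAction n a x) = cliffordAction n a (parity n x) := by
  have ha' : a ∈ CliffordAlgebra.evenOdd (negForm (2 * n)) 0 := ha
  clear ha
  induction a, ha' using CliffordAlgebra.even_induction with
  | algebraMap r =>
    rw [AlgHom.commutes, Module.algebraMap_end_apply, Module.algebraMap_end_apply, real_smul_eq,
      real_smul_eq, map_smul]
  | add a b ha hb iha ihb => simp only [map_add, LinearMap.add_apply, iha, ihb]
  | ι_mul_ι_mul v w a ha iha =>
    have hv : ∀ u, cliffordAction n (CliffordAlgebra.ι _ u) = vectorAction n u := fun u =>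
      CliffordAlgebra.lift_ι_apply _ _ _
    simp only [map_mul, Module.End.mul_apply, hv, parity_vectorAction, iha, map_neg, neg_neg]

theorem cliffordAction_mem_evenSpinors (n : ℕ) {a : CliffordAlgebra (negForm (2 * n))}
    (ha : a ∈ CliffordAlgebra.even (negForm (2 * n))) {x : Spinors n}
    (hx : x ∈ evenSpinors n) : cliffordAction n a x ∈ evenSpinors n := by
  rw [mem_evenSpinors_iff] at hx ⊢
  rw [parity_cliffordAction n ha, hx]

/-- The spin representation `Δ` of `Spin(2n+1)`, on `Λ^* ℂ^n`. -/
def spinRep (n : ℕ) : Representation ℂ (Spin (2 * n + 1)) (Spinors n) where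
  toFun g := oddCliffordAction n g.1
  map_one' := map_one _
  map_mul' g h := map_mul (oddCliffordAction n) g.1 h.1

/-- The half-spin representation `Δ⁺` of `Spin(2n)`, on `Λ^even ℂ^n`. -/
def halfSpinRepPlus (n : ℕ) : Representation ℂ (Spin (2 * n)) (evenSpinors n) where
  toFun g := (cliffordAction n g.1).restrict fun _ hx =>
    cliffordAction_mem_evenSpinors n (spinGroup.mem_even g.2) hx
  map_one' := by
    ext x
    simp
  map_mul' g h := by
    ext x
    simp

/-! ### Lie group structures on subgroups of matrix algebras -/

/-- A Lie group structure on a group `G` of elements of a finite-dimensional real vector space `A`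
(here a matrix algebra or a Clifford algebra, with `incl : G → A` the inclusion) whose underlying
manifold is an embedded smooth submanifold of `A`, identified with some `ℝ^N` by a linear
isomorphism. The topology and the smooth structure are determined by these properties. -/
structure EmbeddedLieGroup {G A : Type} [Group G] [AddCommGroup A] [Module ℝ A]
    (incl : G → A) where
  /-- the topology -/
  top : TopologicalSpace G
  /-- the dimension -/
  dim : ℕ
  /-- the charts -/
  charts : ChartedSpace (EuclideanSpace ℝ (Fin dim)) G
  lieGroup : LieGroup (𝓡 dim) ∞ G
  embedded : ∃ (N : ℕ) (e : A ≃ₗ[ℝ] EuclideanSpace ℝ (Fin N)),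
    Manifold.IsSmoothEmbedding (𝓡 dim) (𝓡 N) ∞ (fun g => e (incl g))

/-- A group isomorphism is an isomorphism of Lie groups if it and its inverse are smooth. -/
def IsLieGroupIso {G A H B : Type} [Group G] [AddCommGroup A] [Module ℝ A] [Group H]
    [AddCommGroup B] [Module ℝ B] {i : G → A} {j : H → B}
    (S : EmbeddedLieGroup i) (T : EmbeddedLieGroup j) (f : G ≃* H) : Prop :=
  letI := S.top
  letI := S.charts
  letI := T.top
  letI := T.charts
  ContMDiff (𝓡 S.dim) (𝓡 T.dim) ∞ f ∧ ContMDiff (𝓡 T.dim) (𝓡 S.dim) ∞ f.symm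

end SpinGroups

end

/-! Both isomorphisms come from one linear principle, `CliffordPair.exists_mulEquiv`. The even part
of the Clifford algebra of `ℝ^(m+1)` has real dimension `2^m`, which is 32 = dim `M₄(ℂ)` for `ℝ⁶`
and 16 = dim `M₂(ℍ)` for `ℝ⁵`. Suppose the half-spin representation carries the spin group onto a
matrix group `H` whose real span is the whole matrix algebra. Then it is a surjective linear map
from the even part onto the matrix algebra, hence bijective by dimension. So it is injective on the
spin group, and both the group isomorphism and its inverse are restrictions of linear maps.
Smoothness is then automatic, for any choice of embedded structures (`contMDiff_of_linearMap`); no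
covering argument is needed.

Three facts remain for each group. The image lies in `H`: the Clifford involution becomes the
conjugate transpose, so spin elements act unitarily, and in dimension six the Lipschitz group acts
by blocks with positive real determinant, which together with unitarity forces determinant 1. The
image is all of `H`: rotors `c + s e_a e_b` are explicit matrices, products of two commuting rotors
act on a single coordinate or coordinate pair, and elimination by such matrices reduces every
element of `H` to something known to be in the image (`mem_spinImage₅_of_mem_Sp`,
`mem_spinImage₆_of_mem_SU`). Finally `H` spans (`span_Sp`, `span_SU`).

The Lie group structures come from the exponential map. Near 0, `exp X` lies in the group exactly
when `X` lies in a linear subspace, so translated logarithms are slice charts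
(`nonempty_embeddedLieGroup_of_exp`). The structures on the spin groups are carried over from
`SU(4)` and `Sp(2)` by the linear inverse of the half-spin representation. -/

namespace SpinGroups

open Topology Set

/-! ### Embedded submanifolds from slice charts -/

section Slices

variable {G E F : Type} [NormedAddCommGroup E] [NormedSpace ℝ E] [NormedAddCommGroup F]
  [NormedSpace ℝ F]

/-- Near `x`, a smooth change of coordinates straightens the set `S` to the range of `ι`. -/
structure IsSliceChart (S : Set E) (ι : F →L[ℝ] E) (x : E) (ψ : OpenPartialHomeomorph E E) :
    Prop where
  mem_source : x ∈ ψ.source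
  contDiffOn : ContDiffOn ℝ ∞ ψ ψ.source
  contDiffOn_symm : ContDiffOn ℝ ∞ ψ.symm ψ.target
  mem_range_iff : ∀ y ∈ ψ.source, ψ y ∈ range ι ↔ y ∈ S

/-- The chart of a subset of `E` obtained by restricting a slice chart. -/
noncomputable def restrictSlice [TopologicalSpace G] [Nonempty G] {j : G → E} (hj : IsEmbedding j)
    {ι : F →L[ℝ] E} {π : E →L[ℝ] F} (hπ : ∀ y, π (ι y) = y) {x : E}
    {ψ : OpenPartialHomeomorph E E} (hψ : IsSliceChart (range j) ι x ψ) :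
    OpenPartialHomeomorph G F where
  toFun g := π (ψ (j g))
  -- `Function.invFun` is meaningful only on the range of `j`; for `ι y` in the target,
  -- `mem_range_iff` puts `ψ.symm (ι y)` there.
  invFun y := Function.invFun j (ψ.symm (ι y))
  source := j ⁻¹' ψ.source
  target := ι ⁻¹' ψ.target
  map_source' g hg := by
    obtain ⟨y, hy⟩ := (hψ.mem_range_iff _ hg).2 (mem_range_self g)
    rw [mem_preimage, ← hy, hπ, hy]
    exact ψ.map_source hg
  map_target' y hy := by
    have h : ψ.symm (ι y) ∈ range j := by
      rw [← hψ.mem_range_iff _ (ψ.map_target hy), ψ.right_inv hy]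
      exact mem_range_self y
    rw [mem_preimage, Function.invFun_eq h]
    exact ψ.map_target hy
  left_inv' g hg := by
    obtain ⟨y, hy⟩ := (hψ.mem_range_iff _ hg).2 (mem_range_self g)
    rw [← hy, hπ, hy, ψ.left_inv hg, Function.leftInverse_invFun hj.injective]
  right_inv' y hy := by
    have h : ψ.symm (ι y) ∈ range j := by
      rw [← hψ.mem_range_iff _ (ψ.map_target hy), ψ.right_inv hy]
      exact mem_range_self y
    rw [Function.invFun_eq h, ψ.right_inv hy, hπ]
  open_source := ψ.open_source.preimage hj.continuous
  open_target := ψ.open_target.preimage ι.continuous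
  continuousOn_toFun := π.continuous.comp_continuousOn
    (ψ.continuousOn.comp hj.continuous.continuousOn fun _ h => h)
  continuousOn_invFun := by
    rw [hj.isInducing.continuousOn_iff]
    refine (ψ.continuousOn_symm.comp ι.continuous.continuousOn fun _ h => h).congr ?_
    intro y hy
    have h : ψ.symm (ι y) ∈ range j := by
      rw [← hψ.mem_range_iff _ (ψ.map_target hy), ψ.right_inv hy]
      exact mem_range_self y
    exact Function.invFun_eq h

/-- Moves every question about the inverse chart to the ambient space, where `ψ.symm` is smooth. -/
theorem restrictSlice_symm_apply [TopologicalSpace G] [Nonempty G] {j : G → E}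
    (hj : IsEmbedding j) {ι : F →L[ℝ] E} {π : E →L[ℝ] F} (hπ : ∀ y, π (ι y) = y) {x : E}
    {ψ : OpenPartialHomeomorph E E} (hψ : IsSliceChart (range j) ι x ψ) {y : F}
    (hy : ι y ∈ ψ.target) : j ((restrictSlice hj hπ hψ).symm y) = ψ.symm (ι y) := by
  have h : ψ.symm (ι y) ∈ range j := by
    rw [← hψ.mem_range_iff _ (ψ.map_target hy), ψ.right_inv hy]
    exact mem_range_self y
  exact Function.invFun_eq h

/-- The charted space given by a family of slice charts. -/
@[reducible]
noncomputable def chartedSpaceOfSlices [TopologicalSpace G] [Nonempty G] {j : G → E}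
    (hj : IsEmbedding j) {ι : F →L[ℝ] E} {π : E →L[ℝ] F} (hπ : ∀ y, π (ι y) = y)
    {ψ : G → OpenPartialHomeomorph E E} (hψ : ∀ g, IsSliceChart (range j) ι (j g) (ψ g)) :
    ChartedSpace F G where
  atlas := range fun g => restrictSlice hj hπ (hψ g)
  chartAt g := restrictSlice hj hπ (hψ g)
  mem_chart_source g := (hψ g).mem_source
  chart_mem_atlas g := mem_range_self g

/-- Each transition map is `π ∘ ψ_h ∘ ψ_g.symm ∘ ι` on its domain, a composite of smooth ambient
maps. -/
theorem isManifold_of_slices [TopologicalSpace G] [Nonempty G] {j : G → E}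
    (hj : IsEmbedding j) {ι : F →L[ℝ] E} {π : E →L[ℝ] F} (hπ : ∀ y, π (ι y) = y)
    {ψ : G → OpenPartialHomeomorph E E} (hψ : ∀ g, IsSliceChart (range j) ι (j g) (ψ g)) :
    letI := chartedSpaceOfSlices hj hπ hψ
    IsManifold 𝓘(ℝ, F) ∞ G := by
  let := chartedSpaceOfSlices hj hπ hψ
  apply isManifold_of_contDiffOn
  rintro _ _ ⟨g, rfl⟩ ⟨h, rfl⟩
  have key : ∀ y ∈ ((restrictSlice hj hπ (hψ g)).symm ≫ₕ restrictSlice hj hπ (hψ h)).source,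
      ι y ∈ (ψ g).target ∧ (ψ g).symm (ι y) ∈ (ψ h).source := by
    intro y hy
    rw [OpenPartialHomeomorph.trans_source] at hy
    have h1 : ι y ∈ (ψ g).target := hy.1
    have h2 : j ((restrictSlice hj hπ (hψ g)).symm y) ∈ (ψ h).source := hy.2
    rw [restrictSlice_symm_apply hj hπ (hψ g) h1] at h2
    exact ⟨h1, h2⟩
  simp only [modelWithCornersSelf_coe, modelWithCornersSelf_coe_symm, range_id, inter_univ,
    preimage_id, Function.comp_id, Function.id_comp]
  have hc : ContDiffOn ℝ ∞ (fun y => π (ψ h ((ψ g).symm (ι y))))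
      ((restrictSlice hj hπ (hψ g)).symm ≫ₕ restrictSlice hj hπ (hψ h)).source :=
    π.contDiff.comp_contDiffOn ((hψ h).contDiffOn.comp
      ((hψ g).contDiffOn_symm.comp ι.contDiff.contDiffOn fun y hy => (key y hy).1)
      fun y hy => (key y hy).2)
  refine hc.congr fun y hy => ?_
  rw [← restrictSlice_symm_apply hj hπ (hψ g) (key y hy).1]
  rfl

theorem mem_maximalAtlas_of_contDiffOn {ψ : OpenPartialHomeomorph E E}
    (h : ContDiffOn ℝ ∞ ψ ψ.source) (h' : ContDiffOn ℝ ∞ ψ.symm ψ.target) :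
    ψ ∈ IsManifold.maximalAtlas 𝓘(ℝ, E) ∞ E := by
  apply StructureGroupoid.mem_maximalAtlas_of_mem_groupoid
  rw [contDiffGroupoid, mem_groupoid_of_pregroupoid]
  simpa [contDiffPregroupoid] using ⟨h, h'⟩

/-- A split injection identifies the target with the product of the source and a complement. -/
noncomputable def prodKerEquiv {ι : F →L[ℝ] E} {π : E →L[ℝ] F} (hπ : ∀ y, π (ι y) = y) :
    (F × LinearMap.ker (π : E →ₗ[ℝ] F)) ≃L[ℝ] E where
  toFun p := ι p.1 + p.2
  invFun x := (π x, ⟨x - ι (π x), by simp [hπ]⟩)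
  map_add' p q := by
    simp only [Prod.fst_add, Prod.snd_add, map_add, Submodule.coe_add]
    abel
  map_smul' t p := by simp
  left_inv p := by
    have h : π (p.2 : E) = 0 := p.2.2
    ext <;> simp [hπ, h]
  right_inv x := by simp
  continuous_toFun := by fun_prop
  continuous_invFun := by
    refine π.continuous.prodMk ?_
    exact Continuous.subtype_mk (by fun_prop) _

/-- Read in the restricted chart and in `ψ`, the inclusion is `ι`; under `F × ker π ≃ E` this is `y
↦ (y, 0)`, the normal form of an immersion. -/
theorem isSmoothEmbedding_of_slices [TopologicalSpace G] [Nonempty G] {j : G → E}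
    (hj : IsEmbedding j) {ι : F →L[ℝ] E} {π : E →L[ℝ] F} (hπ : ∀ y, π (ι y) = y)
    {ψ : G → OpenPartialHomeomorph E E} (hψ : ∀ g, IsSliceChart (range j) ι (j g) (ψ g)) :
    letI := chartedSpaceOfSlices hj hπ hψ
    Manifold.IsSmoothEmbedding 𝓘(ℝ, F) 𝓘(ℝ, E) ∞ j := by
  let := chartedSpaceOfSlices hj hπ hψ
  have : IsManifold 𝓘(ℝ, F) ∞ G := isManifold_of_slices hj hπ hψ
  refine ⟨⟨LinearMap.ker (π : E →ₗ[ℝ] F), inferInstance, inferInstance, fun g => ?_⟩, hj⟩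
  refine Manifold.IsImmersionAtOfComplement.mk_of_charts (prodKerEquiv hπ)
    (restrictSlice hj hπ (hψ g)) (ψ g) (hψ g).mem_source (hψ g).mem_source
    (IsManifold.chart_mem_maximalAtlas g)
    (mem_maximalAtlas_of_contDiffOn (hψ g).contDiffOn (hψ g).contDiffOn_symm) subset_rfl ?_
  intro y hy
  have hy' : ι y ∈ (ψ g).target := by
    have h : y ∈ (restrictSlice hj hπ (hψ g)).target := by
      simpa [OpenPartialHomeomorph.extend] using hy
    exact h
  simp only [mfld_simps, Function.comp_apply, OpenPartialHomeomorph.extend]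
  rw [restrictSlice_symm_apply hj hπ (hψ g) hy', (ψ g).right_inv hy']
  simp [prodKerEquiv]

end Slices

end SpinGroups

/-! ### Lie group structures and smooth maps read in the ambient space -/

namespace SpinGroups

open Topology Set

/-- A map into an embedded submanifold is smooth as soon as its composite with the embedding is, so
the group operations inherit smoothness from `μ` and `ν`. Inversion is assumed smooth only at points
of the group, since in an algebra it is not smooth everywhere. -/
theorem nonempty_embeddedLieGroup_of_slices {G A : Type} [Group G] [AddCommGroup A] [Module ℝ A]
    {incl : G → A} (hincl : Function.Injective incl) {N d : ℕ}
    (e : A ≃ₗ[ℝ] EuclideanSpace ℝ (Fin N))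
    {ι : EuclideanSpace ℝ (Fin d) →L[ℝ] EuclideanSpace ℝ (Fin N)}
    {π : EuclideanSpace ℝ (Fin N) →L[ℝ] EuclideanSpace ℝ (Fin d)} (hπ : ∀ y, π (ι y) = y)
    {ψ : G → OpenPartialHomeomorph (EuclideanSpace ℝ (Fin N)) (EuclideanSpace ℝ (Fin N))}
    (hψ : ∀ g, IsSliceChart (range fun h => e (incl h)) ι (e (incl g)) (ψ g))
    {μ : EuclideanSpace ℝ (Fin N) × EuclideanSpace ℝ (Fin N) → EuclideanSpace ℝ (Fin N)}
    (hμ : ContDiff ℝ ∞ μ) (hμ' : ∀ g h, e (incl (g * h)) = μ (e (incl g), e (incl h)))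
    {ν : EuclideanSpace ℝ (Fin N) → EuclideanSpace ℝ (Fin N)}
    (hν : ∀ g, ContDiffAt ℝ ∞ ν (e (incl g))) (hν' : ∀ g, e (incl g⁻¹) = ν (e (incl g))) :
    Nonempty (EmbeddedLieGroup incl) := by
  let top : TopologicalSpace G := .induced (fun h => e (incl h)) inferInstance
  have hj : IsEmbedding (fun h => e (incl h)) := ⟨⟨rfl⟩, e.injective.comp hincl⟩
  let charts := chartedSpaceOfSlices hj hπ hψ
  have hM : IsManifold (𝓡 d) ∞ G := isManifold_of_slices hj hπ hψ
  have hemb : Manifold.IsSmoothEmbedding (𝓡 d) (𝓡 N) ∞ (fun h => e (incl h)) :=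
    isSmoothEmbedding_of_slices hj hπ hψ
  have hsm := hemb.contMDiff
  refine ⟨⟨top, d, charts, { hM with contMDiff_mul := ?_, contMDiff_inv := ?_ }, N, e, hemb⟩⟩
  · have h : (fun h => e (incl h)) ∘ (fun p : G × G => p.1 * p.2) =
        μ ∘ fun p => (e (incl p.1), e (incl p.2)) := funext fun p => hμ' p.1 p.2
    have h1 : ContMDiff ((𝓡 d).prod (𝓡 d)) (𝓡 N) ∞
        ((fun h => e (incl h)) ∘ (fun p : G × G => p.1 * p.2)) := by
      rw [h]
      exact hμ.contMDiff.comp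
        ((hsm.comp contMDiff_fst).prodMk_space (hsm.comp contMDiff_snd))
    exact (ContMDiff.iff_comp_isImmersion hemb.isImmersion).2
      ⟨hj.isInducing.continuous_iff.2 h1.continuous, h1⟩
  · have h : (fun h => e (incl h)) ∘ (fun g : G => g⁻¹) = ν ∘ fun g => e (incl g) :=
      funext fun g => hν' g
    have h1 : ContMDiff (𝓡 d) (𝓡 N) ∞ ((fun h => e (incl h)) ∘ (fun g : G => g⁻¹)) := by
      rw [h]
      exact fun g => (hν g).contMDiffAt.comp g (hsm g)
    exact (ContMDiff.iff_comp_isImmersion hemb.isImmersion).2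
      ⟨hj.isInducing.continuous_iff.2 h1.continuous, h1⟩

/-- A map between embedded Lie groups that extends to a linear map of the ambient spaces is
smooth. -/
theorem contMDiff_of_linearMap {G A H B : Type} [Group G] [AddCommGroup A] [Module ℝ A] [Group H]
    [AddCommGroup B] [Module ℝ B] {i : G → A} {j : H → B}
    (S : EmbeddedLieGroup i) (T : EmbeddedLieGroup j) (f : G → H) (Λ : A →ₗ[ℝ] B)
    (h : ∀ g, j (f g) = Λ (i g)) :
    letI := S.top
    letI := S.charts
    letI := T.top
    letI := T.charts
    ContMDiff (𝓡 S.dim) (𝓡 T.dim) ∞ f := by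
  let := S.top
  let := S.charts
  let := T.top
  let := T.charts
  obtain ⟨N, e, he⟩ := S.embedded
  obtain ⟨N', e', he'⟩ := T.embedded
  let K := LinearMap.toContinuousLinearMap (e'.toLinearMap ∘ₗ Λ ∘ₗ e.symm.toLinearMap)
  have h1 : (fun g => e' (j g)) ∘ f = K ∘ fun g => e (i g) := by
    funext g
    simp [K, h]
  have h2 : ContMDiff (𝓡 S.dim) (𝓡 N') ∞ ((fun g => e' (j g)) ∘ f) := by
    rw [h1]
    exact K.contDiff.contMDiff.comp he.contMDiff
  exact (ContMDiff.iff_comp_isImmersion he'.isImmersion).2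
    ⟨he'.isEmbedding.isInducing.continuous_iff.2 h2.continuous, h2⟩

/-! ### Logarithmic charts on groups inside an algebra -/

section Log

variable {M : Type} [NormedRing M] [NormedAlgebra ℝ M] [FiniteDimensional ℝ M]

/-- A logarithm near `1`, as a partial homeomorphism, inside a given neighbourhood of `0`. -/
theorem exists_log {p : M → Prop} (hp : ∀ᶠ X in 𝓝 (0 : M), p X) :
    ∃ φ : OpenPartialHomeomorph M M, 1 ∈ φ.source ∧ φ 1 = 0 ∧ ContDiffOn ℝ ∞ φ φ.source ∧
      ContDiffOn ℝ ∞ φ.symm φ.target ∧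
      ∀ y ∈ φ.source, p (φ y) ∧ NormedSpace.exp (φ y) = y := by
  have : CompleteSpace M := FiniteDimensional.complete ℝ M
  -- Order `ω` instead of `∞`: being `C^ω` at a point is an open condition, while being `C^∞` at a
  -- point in the sense of `ContDiffAt` need not be.
  have hexp : ∀ X : M, ContDiffAt ℝ ω NormedSpace.exp X := fun X =>
    (NormedSpace.exp_analytic (𝕂 := ℝ) X).contDiffAt
  have hd : HasFDerivAt (NormedSpace.exp : M → M)
      ((ContinuousLinearEquiv.refl ℝ M : M ≃L[ℝ] M) : M →L[ℝ] M) 0 :=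
    hasFDerivAt_exp_zero (𝕂 := ℝ)
  let E := (hexp 0).toOpenPartialHomeomorph NormedSpace.exp hd (by simp)
  have hE : ∀ x, E x = NormedSpace.exp x := fun x => rfl
  have h0 : (0 : M) ∈ E.source := (hexp 0).mem_toOpenPartialHomeomorph_source hd (by simp)
  have hE0 : E 0 = 1 := by rw [hE, NormedSpace.exp_zero]
  have h1 : (1 : M) ∈ E.target := hE0 ▸ E.map_source h0
  have hE1 : E.symm 1 = 0 := by rw [← hE0, E.left_inv h0]
  have hinv : ContDiffAt ℝ ω E.symm 1 := by
    have := (hexp 0).to_localInverse hd (by simp)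
    rw [NormedSpace.exp_zero] at this
    exact this
  have hev : ∀ᶠ y in 𝓝 (1 : M), ContDiffAt ℝ ω E.symm y ∧ p (E.symm y) := by
    refine (hinv.eventually (by simp)).and ?_
    exact (E.symm.continuousAt h1).eventually (by rwa [hE1])
  obtain ⟨U, hU, hUo, hU1⟩ := eventually_nhds_iff.1 hev
  refine ⟨E.symm.restrOpen U hUo, ⟨h1, hU1⟩, hE1, ?_, ?_, ?_⟩
  · rintro y ⟨-, hy⟩
    exact ((hU y hy).1.of_le (by simp)).contDiffWithinAt
  · intro y hy
    exact ((hexp y).of_le (by simp)).contDiffWithinAt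
  · rintro y ⟨hy, hy'⟩
    exact ⟨(hU y hy').2, E.right_inv hy⟩

/-- A subgroup of the units of a finite-dimensional algebra `M` that is straightened by the
exponential map near `1` is an embedded Lie group, in `M` and in every larger vector space. -/
theorem nonempty_embeddedLieGroup_of_exp {G A : Type} [Group G] [AddCommGroup A] [Module ℝ A]
    [Module.Finite ℝ A] {incl : G → A} (ρ : G →* M) (hρ : Function.Injective ρ)
    (L : M →ₗ[ℝ] A) (hL : Function.Injective L) (hincl : ∀ g, incl g = L (ρ g))
    (𝔤 : Submodule ℝ M) (h𝔤 : ∀ᶠ X in 𝓝 (0 : M), NormedSpace.exp X ∈ range ρ ↔ X ∈ 𝔤) :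
    Nonempty (EmbeddedLieGroup incl) := by
  have : CompleteSpace M := FiniteDimensional.complete ℝ M
  obtain ⟨φ, hφ1, -, hφ, hφs, hφp⟩ := exists_log h𝔤
  obtain ⟨e⟩ : Nonempty (A ≃ₗ[ℝ] EuclideanSpace ℝ (Fin (Module.finrank ℝ A))) :=
    FiniteDimensional.nonempty_linearEquiv_of_finrank_eq (by simp)
  obtain ⟨w⟩ : Nonempty (EuclideanSpace ℝ (Fin (Module.finrank ℝ 𝔤)) ≃ₗ[ℝ] 𝔤) :=
    FiniteDimensional.nonempty_linearEquiv_of_finrank_eq (by simp)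
  let K := LinearMap.toContinuousLinearMap (e.toLinearMap ∘ₗ L)
  have hK : Function.Injective K := e.injective.comp hL
  obtain ⟨P', hP'⟩ := (e.toLinearMap ∘ₗ L).exists_leftInverse_of_injective
    (LinearMap.ker_eq_bot.2 hK)
  let P := LinearMap.toContinuousLinearMap P'
  have hP : ∀ m, P (K m) = m := fun m => LinearMap.congr_fun hP' m
  let ι := LinearMap.toContinuousLinearMap
    (e.toLinearMap ∘ₗ L ∘ₗ 𝔤.subtype ∘ₗ w.toLinearMap)
  have hι : Function.Injective ι := hK.comp (Subtype.val_injective.comp w.injective)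
  obtain ⟨π', hπ'⟩ := (e.toLinearMap ∘ₗ L ∘ₗ 𝔤.subtype ∘ₗ
    w.toLinearMap).exists_leftInverse_of_injective (LinearMap.ker_eq_bot.2 hι)
  let π := LinearMap.toContinuousLinearMap π'
  have hπ : ∀ y, π (ι y) = y := fun y => LinearMap.congr_fun hπ' y
  have hιr : ∀ x, x ∈ range ι ↔ ∃ X ∈ 𝔤, K X = x := by
    intro x
    constructor
    · rintro ⟨y, rfl⟩
      exact ⟨w y, (w y).2, rfl⟩
    · rintro ⟨X, hX, rfl⟩
      refine ⟨w.symm ⟨X, hX⟩, ?_⟩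
      change K (w (w.symm ⟨X, hX⟩) : M) = K X
      rw [w.apply_symm_apply]
  have hj : ∀ g, e (incl g) = K (ρ g) := fun g => by rw [hincl]; rfl
  have hinv : ∀ g, ρ g⁻¹ * ρ g = 1 := fun g => by rw [← map_mul, inv_mul_cancel, map_one]
  have hinv' : ∀ g, ρ g * ρ g⁻¹ = 1 := fun g => by rw [← map_mul, mul_inv_cancel, map_one]
  have hφs' : ∀ y ∈ φ.target, φ.symm y ∈ φ.source := fun y hy => φ.map_target hy
  -- Split the ambient space as `K(M) ⊕ ker P`. On `K(M)` the chart at `g` translates by `g⁻¹` and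
  -- takes the logarithm; on `ker P` it is the identity.
  let ψ : G → OpenPartialHomeomorph (EuclideanSpace ℝ (Fin (Module.finrank ℝ A)))
      (EuclideanSpace ℝ (Fin (Module.finrank ℝ A))) := fun g =>
    { toFun := fun x => x - K (P x) + K (φ (ρ g⁻¹ * P x))
      invFun := fun y => y - K (P y) + K (ρ g * φ.symm (P y))
      source := {x | ρ g⁻¹ * P x ∈ φ.source}
      target := {y | P y ∈ φ.target}
      map_source' := fun x hx => by
        simpa [hP] using φ.map_source hx
      map_target' := fun y hy => by
        simpa [hP, ← mul_assoc, hinv] using φ.map_target hy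
      left_inv' := fun x hx => by
        have h := φ.left_inv hx
        simp [hP, h, ← mul_assoc, hinv']
      right_inv' := fun y hy => by
        have h := φ.right_inv hy
        simp [hP, h, ← mul_assoc, hinv]
      open_source := φ.open_source.preimage (by fun_prop)
      open_target := φ.open_target.preimage P.continuous
      continuousOn_toFun := by
        refine ContinuousOn.add (by fun_prop) (K.continuous.comp_continuousOn ?_)
        exact φ.continuousOn.comp (by fun_prop) fun x hx => hx
      continuousOn_invFun := by
        refine ContinuousOn.add (by fun_prop) (K.continuous.comp_continuousOn ?_)
        exact continuousOn_const.mul (φ.continuousOn_symm.comp (by fun_prop) fun x hx => hx) }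
  have hψ : ∀ g, IsSliceChart (range fun h => e (incl h)) ι (e (incl g)) (ψ g) := by
    intro g
    refine ⟨?_, ?_, ?_, ?_⟩
    · change ρ g⁻¹ * P (e (incl g)) ∈ φ.source
      rwa [hj, hP, hinv]
    · refine ContDiffOn.add (by fun_prop) (K.contDiff.comp_contDiffOn ?_)
      exact hφ.comp (contDiff_const.mul P.contDiff).contDiffOn fun x hx => hx
    · refine ContDiffOn.add (by fun_prop) (K.contDiff.comp_contDiffOn ?_)
      exact contDiffOn_const.mul (hφs.comp P.contDiff.contDiffOn fun x hx => hx)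
    · intro x hx
      have hiff := (hφp _ hx).1
      rw [(hφp _ hx).2] at hiff
      rw [hιr]
      change (∃ X ∈ 𝔤, K X = x - K (P x) + K (φ (ρ g⁻¹ * P x))) ↔ _
      constructor
      · rintro ⟨X, hX, hXx⟩
        have h1 : X = φ (ρ g⁻¹ * P x) := by simpa [hP] using congrArg P hXx
        -- The value lies in `K(M)`, so the `ker P` component `x - K (P x)` of the point vanishes.
        rw [← h1, right_eq_add, sub_eq_zero] at hXx
        rw [h1, ← hiff] at hX
        obtain ⟨h, hh⟩ := hX
        refine ⟨g * h, ?_⟩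
        change e (incl (g * h)) = x
        rw [hj, map_mul, hh, ← mul_assoc, hinv', one_mul, ← hXx]
      · rintro ⟨h, rfl⟩
        change ρ g⁻¹ * P (e (incl h)) ∈ φ.source at hx
        simp only [hj, hP] at hiff ⊢
        exact ⟨_, hiff.1 ⟨g⁻¹ * h, map_mul _ _ _⟩, by simp⟩
  refine nonempty_embeddedLieGroup_of_slices (fun g h hgh => ?_) e hπ hψ
    (μ := fun p => K (P p.1 * P p.2)) ?_ ?_ (ν := fun x => K (Ring.inverse (P x))) ?_ ?_
  · rw [hincl, hincl] at hgh
    exact hρ (hL hgh)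
  · fun_prop
  · intro g h
    simp only [hj, hP, map_mul]
  · intro g
    have h1 : ContDiffAt ℝ ∞ Ring.inverse (P (e (incl g))) := by
      rw [hj, hP]
      exact contDiffAt_ringInverse ℝ (⟨ρ g, ρ g⁻¹, hinv' g, hinv g⟩ : Mˣ)
    exact K.contDiff.contDiffAt.comp _ (h1.comp _ P.contDiff.contDiffAt)
  · intro g
    rw [hj, hj, hP]
    congr 1
    exact (Ring.inverse_unit (⟨ρ g, ρ g⁻¹, hinv' g, hinv g⟩ : Mˣ)).symm

end Log

end SpinGroups

/-! ### Exponential description of unitary groups, `SU(n)` and `Sp(n)` -/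

namespace SpinGroups

open Topology Set

section Exp

variable {M : Type} [NormedRing M] [NormedAlgebra ℝ M] [CompleteSpace M]

/-- The exponential map has a left inverse near `0`. -/
theorem exists_exp_leftInverse (M : Type) [NormedRing M] [NormedAlgebra ℝ M] [CompleteSpace M] :
    ∃ l : M → M, ∀ᶠ X in 𝓝 (0 : M), l (NormedSpace.exp X) = X := by
  have hd : HasStrictFDerivAt (NormedSpace.exp : M → M)
      ((ContinuousLinearEquiv.refl ℝ M : M ≃L[ℝ] M) : M →L[ℝ] M) 0 :=
    hasStrictFDerivAt_exp_zero (𝕂 := ℝ)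
  exact ⟨_, hd.eventually_left_inverse⟩

theorem exp_mul_exp_neg (X : M) : NormedSpace.exp X * NormedSpace.exp (-X) = 1 := by
  let : NormedAlgebra ℚ M := NormedAlgebra.restrictScalars ℚ ℝ M
  rw [← NormedSpace.exp_add_of_commute (Commute.neg_right rfl), add_neg_cancel,
    NormedSpace.exp_zero]

/-- Unitarity of `exp X` says `exp (star X) = (exp X)⁻¹ = exp (-X)`, and near 0 the exponential is
injective. -/
theorem eventually_exp_mem_unitary [StarRing M] (hs : Continuous (star : M → M)) :
    ∀ᶠ X in 𝓝 (0 : M), NormedSpace.exp X ∈ unitary M ↔ star X = -X := by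
  have : ContinuousStar M := ⟨hs⟩
  obtain ⟨l, hl⟩ := exists_exp_leftInverse M
  have h1 : ∀ᶠ X in 𝓝 (0 : M), l (NormedSpace.exp (star X)) = star X := by
    have : Filter.Tendsto (star : M → M) (𝓝 0) (𝓝 0) := by
      simpa using (continuous_star (R := M)).tendsto 0
    exact this.eventually hl
  have h2 : ∀ᶠ X in 𝓝 (0 : M), l (NormedSpace.exp (-X)) = -X := by
    have : Filter.Tendsto (fun X : M => -X) (𝓝 0) (𝓝 0) := by
      simpa using (continuous_neg (G := M)).tendsto 0
    exact this.eventually hl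
  filter_upwards [h1, h2] with X h1 h2
  constructor
  · intro h
    have h3 : NormedSpace.exp (star X) = NormedSpace.exp (-X) := by
      rw [← NormedSpace.star_exp]
      exact left_inv_eq_right_inv (Unitary.star_mul_self_of_mem h) (exp_mul_exp_neg X)
    rw [← h1, h3, h2]
  · intro h
    have h3 : star (NormedSpace.exp X) = NormedSpace.exp (-X) := by
      rw [NormedSpace.star_exp, h]
    have h4 := exp_mul_exp_neg (-X)
    rw [neg_neg] at h4
    exact Unitary.mem_iff.2 ⟨by rw [h3, h4], by rw [h3, exp_mul_exp_neg]⟩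

end Exp

open scoped Matrix.Norms.Operator

/-- The matrix `iX` is Hermitian, so `X` is unitarily diagonalizable with eigenvalues `-i` times
real numbers; for diagonal matrices the formula says that `exp` turns sums into products. -/
theorem det_exp_of_conjTranspose_eq_neg {n : ℕ} {X : Matrix (Fin n) (Fin n) ℂ}
    (hX : X.conjTranspose = -X) : (NormedSpace.exp X).det = NormedSpace.exp X.trace := by
  have hY : (Complex.I • X).IsHermitian := by
    rw [Matrix.IsHermitian, Matrix.conjTranspose_smul, hX]
    simp
  obtain ⟨U, D, hUD⟩ : ∃ (U : Matrix.unitaryGroup (Fin n) ℂ) (D : Fin n → ℂ),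
      X = (U : Matrix (Fin n) (Fin n) ℂ) * Matrix.diagonal D *
        (U : Matrix (Fin n) (Fin n) ℂ)⁻¹ := by
    have h := hY.spectral_theorem
    refine ⟨hY.eigenvectorUnitary, fun i => -Complex.I * hY.eigenvalues i, ?_⟩
    have h1 : X = -Complex.I • Complex.I • X := by simp [smul_smul]
    have h2 : (hY.eigenvectorUnitary : Matrix (Fin n) (Fin n) ℂ)⁻¹ =
        star (hY.eigenvectorUnitary : Matrix (Fin n) (Fin n) ℂ) :=
      Matrix.inv_eq_right_inv (Unitary.coe_mul_star_self _)
    rw [h2]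
    conv_lhs => rw [h1, h, Unitary.conjStarAlgAut_apply]
    rw [← smul_mul_assoc, ← mul_smul_comm, ← Matrix.diagonal_smul]
    rfl
  have hU : IsUnit (U : Matrix (Fin n) (Fin n) ℂ) := (Group.isUnit U).map (Submonoid.subtype _)
  have hU' : IsUnit (U : Matrix (Fin n) (Fin n) ℂ).det := (Matrix.isUnit_iff_isUnit_det _).1 hU
  rw [hUD, Matrix.exp_conj _ _ hU, Matrix.exp_diagonal, Matrix.det_conj hU, Matrix.det_diagonal,
    Matrix.trace_mul_cycle, Matrix.nonsing_inv_mul _ hU', Matrix.one_mul, Matrix.trace_diagonal]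
  simp only [Pi.coe_exp, ← Complex.exp_eq_exp_ℂ]
  exact (Complex.exp_sum _ _).symm

/-- The Lie algebra of traceless skew-Hermitian matrices. -/
def su (n : ℕ) : Submodule ℝ (Matrix (Fin n) (Fin n) ℂ) where
  carrier := {X | star X = -X ∧ X.trace = 0}
  add_mem' := fun ⟨h1, h2⟩ ⟨h3, h4⟩ => ⟨by rw [star_add, h1, h3, neg_add], by
    rw [Matrix.trace_add, h2, h4, add_zero]⟩
  zero_mem' := by simp
  smul_mem' := fun t X ⟨h1, h2⟩ => ⟨by simp [h1], by rw [Matrix.trace_smul, h2, smul_zero]⟩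

/-- The Lie algebra of skew-Hermitian quaternionic matrices. -/
def sp (n : ℕ) : Submodule ℝ (Matrix (Fin n) (Fin n) ℍ) where
  carrier := {X | star X = -X}
  add_mem' := fun {X Y} (h1 : star X = -X) (h2 : star Y = -Y) => by
    change star (X + Y) = -(X + Y)
    rw [star_add, h1, h2, neg_add]
  zero_mem' := by simp
  smul_mem' := fun t X (h1 : star X = -X) => by
    change star (t • X) = -(t • X)
    have h2 : star (t • X) = t • star X := by
      ext i j : 1
      exact Quaternion.star_smul t _
    rw [h2, h1, smul_neg]

/-- For skew-Hermitian `X` the determinant of `exp X` is `exp (tr X)`. Since the complex exponential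
is injective near 0 and the trace is continuous, small `X` have determinant 1 only if the trace
vanishes. -/
theorem eventually_exp_mem_SU (n : ℕ) :
    ∀ᶠ X in 𝓝 (0 : Matrix (Fin n) (Fin n) ℂ), NormedSpace.exp X ∈ SU n ↔ X ∈ su n := by
  have : CompleteSpace (Matrix (Fin n) (Fin n) ℂ) := FiniteDimensional.complete ℝ _
  obtain ⟨l, hl⟩ := exists_exp_leftInverse ℂ
  have ht : Filter.Tendsto (fun X : Matrix (Fin n) (Fin n) ℂ => X.trace) (𝓝 0) (𝓝 0) := by
    have : Continuous (fun X : Matrix (Fin n) (Fin n) ℂ => X.trace) := continuous_id.matrix_trace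
    simpa using this.tendsto 0
  have hl0 := hl.self_of_nhds
  filter_upwards [eventually_exp_mem_unitary (continuous_id.matrix_conjTranspose (n := Fin n)
    (m := Fin n) (R := ℂ)),
    ht.eventually hl] with X h1 h2
  rw [Matrix.mem_specialUnitaryGroup_iff]
  change NormedSpace.exp X ∈ unitary _ ∧ _ ↔ star X = -X ∧ X.trace = 0
  refine (and_congr_left' h1).trans (and_congr_right fun h => ?_)
  rw [det_exp_of_conjTranspose_eq_neg h]
  constructor
  · intro h3
    rw [← h2, h3, ← NormedSpace.exp_zero, hl0]
  · intro h3
    rw [h3, NormedSpace.exp_zero]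

theorem eventually_exp_mem_Sp (n : ℕ) :
    ∀ᶠ X in 𝓝 (0 : Matrix (Fin n) (Fin n) ℍ), NormedSpace.exp X ∈ Sp n ↔ X ∈ sp n := by
  have : CompleteSpace (Matrix (Fin n) (Fin n) ℍ) := FiniteDimensional.complete ℝ _
  exact eventually_exp_mem_unitary continuous_id.matrix_conjTranspose

/-- A group with an isomorphism onto `SU(n)` that extends to a linear embedding of the complex
matrices is an embedded Lie group. -/
theorem nonempty_embeddedLieGroup_of_SU {n : ℕ} {G A : Type} [Group G] [AddCommGroup A]
    [Module ℝ A] [Module.Finite ℝ A] {incl : G → A} (f : G ≃* SU n)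
    (L : Matrix (Fin n) (Fin n) ℂ →ₗ[ℝ] A) (hL : Function.Injective L)
    (h : ∀ g, incl g = L (f g)) : Nonempty (EmbeddedLieGroup incl) := by
  refine nonempty_embeddedLieGroup_of_exp ((SU n).subtype.comp f.toMonoidHom)
    (Subtype.val_injective.comp f.injective) L hL h (su n) ?_
  have hr : range ((SU n).subtype.comp f.toMonoidHom) = SU n := by
    ext X
    exact ⟨by rintro ⟨g, rfl⟩; exact (f g).2, fun hX => ⟨f.symm ⟨X, hX⟩, by simp⟩⟩
  rw [hr]
  exact eventually_exp_mem_SU n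

/-- A group with an isomorphism onto `Sp(n)` that extends to a linear embedding of the quaternionic
matrices is an embedded Lie group. -/
theorem nonempty_embeddedLieGroup_of_Sp {n : ℕ} {G A : Type} [Group G] [AddCommGroup A]
    [Module ℝ A] [Module.Finite ℝ A] {incl : G → A} (f : G ≃* Sp n)
    (L : Matrix (Fin n) (Fin n) ℍ →ₗ[ℝ] A) (hL : Function.Injective L)
    (h : ∀ g, incl g = L (f g)) : Nonempty (EmbeddedLieGroup incl) := by
  refine nonempty_embeddedLieGroup_of_exp ((Sp n).subtype.comp f.toMonoidHom)
    (Subtype.val_injective.comp f.injective) L hL h (sp n) ?_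
  have hr : range ((Sp n).subtype.comp f.toMonoidHom) = Sp n := by
    ext X
    exact ⟨by rintro ⟨g, rfl⟩; exact (f g).2, fun hX => ⟨f.symm ⟨X, hX⟩, by simp⟩⟩
  rw [hr]
  exact eventually_exp_mem_Sp n

end SpinGroups

namespace SpinGroups

open CliffordAlgebra Matrix

/-! ### Dimensions of Clifford algebras -/

theorem finrank_exteriorAlgebra (K : Type) [Field K] (m : ℕ) :
    Module.finrank K (ExteriorAlgebra K (Fin m → K)) = 2 ^ m := by
  rw [Module.finrank_eq_card_basis (Pi.basisFun K (Fin m)).ExteriorAlgebra]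
  simp

instance finite_exteriorAlgebra (K : Type) [Field K] (m : ℕ) :
    Module.Finite K (ExteriorAlgebra K (Fin m → K)) :=
  Module.Finite.of_basis (Pi.basisFun K (Fin m)).ExteriorAlgebra

instance finite_cliffordAlgebra (m : ℕ) : Module.Finite ℝ (CliffordAlgebra (negForm m)) :=
  Module.Finite.equiv (equivExterior (negForm m)).symm

theorem finrank_cliffordAlgebra (m : ℕ) :
    Module.finrank ℝ (CliffordAlgebra (negForm m)) = 2 ^ m := by
  rw [(equivExterior (negForm m)).finrank_eq, finrank_exteriorAlgebra]

/-- The standard basis vectors of `ℝ^m`. -/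
abbrev stdVec {m : ℕ} (a : Fin m) : Fin m → ℝ := Pi.single a 1

theorem negForm_apply {m : ℕ} (v : Fin m → ℝ) : negForm m v = -∑ i, v i * v i := by
  simp [QuadraticMap.weightedSumSquares_apply]

theorem negForm_stdVec {m : ℕ} (a : Fin m) : negForm m (stdVec a) = -1 := by
  simp [Pi.single_apply]

theorem ι_mul_self_of_negForm {m : ℕ} {v : Fin m → ℝ} (hv : negForm m v = -1) :
    ι (negForm m) v * ι (negForm m) v = -1 := by
  rw [ι_sq_scalar, hv, map_neg, map_one]

/-- Left multiplication by a basis vector is injective, its square being `-1`, and exchanges the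
even and odd parts. Each part therefore has half the total dimension. -/
theorem finrank_even (m : ℕ) :
    Module.finrank ℝ (evenOdd (negForm (m + 1)) 0) = 2 ^ m := by
  have h := Submodule.finrank_add_eq_of_isCompl (evenOdd_isCompl (negForm (m + 1)))
  rw [finrank_cliffordAlgebra] at h
  let e := ι (negForm (m + 1)) (stdVec 0)
  have he : e * e = -1 := ι_mul_self_of_negForm (negForm_stdVec 0)
  have hinj : Function.Injective (LinearMap.mulLeft ℝ e) := by
    intro x y hxy
    have := congrArg (e * ·) hxy
    simpa [← mul_assoc, he] using this
  have hle : ∀ i, Module.finrank ℝ (evenOdd (negForm (m + 1)) i) ≤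
      Module.finrank ℝ (evenOdd (negForm (m + 1)) (1 + i)) := by
    intro i
    rw [(Submodule.equivMapOfInjective _ hinj (evenOdd (negForm (m + 1)) i)).finrank_eq]
    refine Submodule.finrank_mono ?_
    rintro _ ⟨x, hx, rfl⟩
    exact evenOdd_mul_le _ _ _ (Submodule.mul_mem_mul (ι_mem_evenOdd_one _ _) hx)
  have h0 := hle 0
  have h1 := hle 1
  rw [show (1 : ZMod 2) + 0 = 1 from rfl] at h0
  rw [show (1 : ZMod 2) + 1 = 0 from rfl] at h1
  rw [pow_succ] at h
  omega

/-! ### Elements of the spin group -/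

theorem ι_mem_pinGroup {m : ℕ} {v : Fin m → ℝ} (hv : negForm m v = -1) :
    ι (negForm m) v ∈ pinGroup (negForm m) := by
  have h := ι_mul_self_of_negForm hv
  refine ⟨⟨⟨ι _ v, -ι _ v, by rw [mul_neg, h, neg_neg], by rw [neg_mul, h, neg_neg]⟩,
    Subgroup.subset_closure ⟨v, rfl⟩, rfl⟩, ?_⟩
  rw [SetLike.mem_coe, Unitary.mem_iff, star_ι, neg_mul, mul_neg, h, neg_neg]
  exact ⟨rfl, rfl⟩

theorem ι_mul_ι_mem_spin {m : ℕ} {v w : Fin m → ℝ} (hv : negForm m v = -1)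
    (hw : negForm m w = -1) : ι (negForm m) v * ι (negForm m) w ∈ Spin m :=
  ⟨mul_mem (ι_mem_pinGroup hv) (ι_mem_pinGroup hw), ι_mul_ι_mem_evenOdd_zero _ _ _⟩

/-- The rotor is the product of the two unit vectors `e_a` and `-c e_a + s e_b`. -/
theorem rotor_mem_spin {m : ℕ} {a b : Fin m} (hab : a ≠ b) {c s : ℝ} (h : c ^ 2 + s ^ 2 = 1) :
    algebraMap ℝ _ c + s • (ι (negForm m) (stdVec a) * ι (negForm m) (stdVec b)) ∈ Spin m := by
  have hw : negForm m (-c • stdVec a + s • stdVec b) = -1 := by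
    have h1 : ∀ i, (-c • stdVec a + s • stdVec b) i * (-c • stdVec a + s • stdVec b) i =
        c ^ 2 * stdVec a i + s ^ 2 * stdVec b i := by
      intro i
      by_cases hia : i = a
      · subst hia
        simp [hab]
        ring
      · by_cases hib : i = b
        · subst hib
          simp [hia]
          ring
        · simp [hia, hib]
    rw [negForm_apply, Finset.sum_congr rfl fun i _ => h1 i, Finset.sum_add_distrib,
      ← Finset.mul_sum, ← Finset.mul_sum]
    simp [h]
  have h2 := ι_mul_ι_mem_spin (negForm_stdVec a) hw
  have h3 : ι (negForm m) (stdVec a) * ι (negForm m) (-c • stdVec a + s • stdVec b) =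
      algebraMap ℝ _ c + s • (ι (negForm m) (stdVec a) * ι (negForm m) (stdVec b)) := by
    rw [map_add, map_smul, map_smul, mul_add, mul_smul_comm, mul_smul_comm,
      ι_mul_self_of_negForm (negForm_stdVec a), smul_neg, neg_smul, neg_neg,
      Algebra.algebraMap_eq_smul_one]
  rwa [h3] at h2

/-! ### Representations in block form -/

theorem algebraMap_eq_fromBlocks {n : ℕ} {K : Type} [Ring K] [Algebra ℝ K] (r : ℝ) :
    algebraMap ℝ (Matrix (Fin n ⊕ Fin n) (Fin n ⊕ Fin n) K) r =
      fromBlocks (algebraMap ℝ _ r) 0 0 (algebraMap ℝ _ r) := by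
  simp only [Algebra.algebraMap_eq_smul_one]
  rw [← fromBlocks_one, fromBlocks_smul, smul_zero]

/-- Matrices `A v`, `B v` by which the vectors of `ℝ^m` map two half-spin modules to each other,
compatibly with conjugate transposes. -/
structure CliffordPair (m n : ℕ) (K : Type) [Ring K] [StarRing K] [Algebra ℝ K] where
  /-- the action from the second module to the first -/
  A : (Fin m → ℝ) →ₗ[ℝ] Matrix (Fin n) (Fin n) K
  /-- the action from the first module to the second -/
  B : (Fin m → ℝ) →ₗ[ℝ] Matrix (Fin n) (Fin n) K
  A_mul_B : ∀ v, A v * B v = algebraMap ℝ _ (negForm m v)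
  B_mul_A : ∀ v, B v * A v = algebraMap ℝ _ (negForm m v)
  conjTranspose_A : ∀ v, (A v)ᴴ = -B v
  star_algebraMap : ∀ r : ℝ, star (algebraMap ℝ K r) = algebraMap ℝ K r

namespace CliffordPair

variable {m n : ℕ} {K : Type} [Ring K] [StarRing K] [Algebra ℝ K] (D : CliffordPair m n K)

theorem conjTranspose_B (v : Fin m → ℝ) : (D.B v)ᴴ = -D.A v := by
  rw [← neg_eq_iff_eq_neg.2 (D.conjTranspose_A v), conjTranspose_neg, conjTranspose_conjTranspose]

/-- The action of vectors on the sum of the two modules. -/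
def vec : (Fin m → ℝ) →ₗ[ℝ] Matrix (Fin n ⊕ Fin n) (Fin n ⊕ Fin n) K where
  toFun v := fromBlocks 0 (D.A v) (D.B v) 0
  map_add' v w := by simp [fromBlocks_add]
  map_smul' t v := by simp [fromBlocks_smul]

theorem vec_sq (v : Fin m → ℝ) : D.vec v * D.vec v = algebraMap ℝ _ (negForm m v) := by
  rw [algebraMap_eq_fromBlocks]
  simp [vec, fromBlocks_multiply, D.A_mul_B, D.B_mul_A]

/-- The action of the Clifford algebra on the sum of the two modules. -/
def rep : CliffordAlgebra (negForm m) →ₐ[ℝ] Matrix (Fin n ⊕ Fin n) (Fin n ⊕ Fin n) K :=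
  lift (negForm m) ⟨D.vec, D.vec_sq⟩

theorem rep_ι (v : Fin m → ℝ) : D.rep (ι _ v) = fromBlocks 0 (D.A v) (D.B v) 0 :=
  lift_ι_apply _ _ _

/-- On vectors the Clifford involution is `v ↦ -v`, which `conjTranspose_A` matches with the
conjugate transpose of the off-diagonal blocks. -/
theorem rep_star (x : CliffordAlgebra (negForm m)) : D.rep (star x) = (D.rep x)ᴴ := by
  induction x using CliffordAlgebra.induction with
  | algebraMap r =>
    have h : (algebraMap ℝ (Matrix (Fin n) (Fin n) K) r)ᴴ = algebraMap ℝ _ r := by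
      rw [algebraMap_eq_diagonal, diagonal_conjTranspose]
      congr 1
      funext i
      exact D.star_algebraMap r
    rw [CliffordAlgebra.star_algebraMap, AlgHom.commutes, algebraMap_eq_fromBlocks,
      fromBlocks_conjTranspose, h, conjTranspose_zero]
  | ι v =>
    rw [star_ι, map_neg, rep_ι, fromBlocks_conjTranspose, D.conjTranspose_A, D.conjTranspose_B,
      fromBlocks_neg]
    simp
  | mul a b ha hb => rw [star_mul, map_mul, map_mul, ha, hb, conjTranspose_mul]
  | add a b ha hb => rw [star_add, map_add, map_add, ha, hb, conjTranspose_add]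

/-- The action of the even Clifford algebra on the first module. -/
def half : CliffordAlgebra (negForm m) →ₗ[ℝ] Matrix (Fin n) (Fin n) K where
  toFun x := (D.rep x).toBlocks₁₁
  map_add' x y := by rw [map_add]; rfl
  map_smul' t x := by rw [map_smul]; rfl

theorem half_star (x : CliffordAlgebra (negForm m)) : D.half (star x) = (D.half x)ᴴ := by
  change (D.rep (star x)).toBlocks₁₁ = _
  rw [rep_star]
  rfl

theorem half_algebraMap (r : ℝ) : D.half (algebraMap ℝ _ r) = algebraMap ℝ _ r := by
  change (D.rep (algebraMap ℝ _ r)).toBlocks₁₁ = _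
  rw [AlgHom.commutes, algebraMap_eq_fromBlocks, toBlocks_fromBlocks₁₁]

theorem half_one : D.half 1 = 1 := by simpa using D.half_algebraMap 1

theorem half_ι_mul_ι_mul (v w : Fin m → ℝ) (x : CliffordAlgebra (negForm m)) :
    D.half (ι _ v * ι _ w * x) = D.A v * D.B w * D.half x := by
  change (D.rep (ι _ v * ι _ w * x)).toBlocks₁₁ = _ * (D.rep x).toBlocks₁₁
  rw [map_mul, map_mul, rep_ι, rep_ι, fromBlocks_multiply]
  conv_lhs => rw [← fromBlocks_toBlocks (D.rep x), fromBlocks_multiply, toBlocks_fromBlocks₁₁]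
  simp

theorem half_ι_mul_ι (v w : Fin m → ℝ) : D.half (ι _ v * ι _ w) = D.A v * D.B w := by
  simpa [half_one] using D.half_ι_mul_ι_mul v w 1

/-- Even elements act block-diagonally, so it is enough that the left factor be even. -/
theorem half_mul {x : CliffordAlgebra (negForm m)} (hx : x ∈ evenOdd (negForm m) 0)
    (y : CliffordAlgebra (negForm m)) : D.half (x * y) = D.half x * D.half y := by
  induction x, hx using even_induction with
  | algebraMap r =>
    rw [half_algebraMap, Algebra.algebraMap_eq_smul_one, Algebra.algebraMap_eq_smul_one,
      smul_one_mul, smul_one_mul, map_smul]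
  | add a b ha hb iha ihb => rw [add_mul, map_add, map_add, iha, ihb, add_mul]
  | ι_mul_ι_mul v w a ha iha =>
    rw [mul_assoc _ a y, half_ι_mul_ι_mul, half_ι_mul_ι_mul, iha, ← mul_assoc]

/-- The half-spin representation in matrix form. -/
def spinHom : Spin m →* Matrix (Fin n) (Fin n) K where
  toFun g := D.half g
  map_one' := D.half_one
  map_mul' g h := D.half_mul (spinGroup.mem_even g.2) h

theorem spinHom_mem_unitary (g : Spin m) : D.spinHom g ∈ unitary (Matrix (Fin n) (Fin n) K) := by
  have h1 : star (g : CliffordAlgebra (negForm m)) ∈ evenOdd (negForm m) 0 :=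
    spinGroup.mem_even (spinGroup.star_mem g.2)
  rw [Unitary.mem_iff]
  change (D.half g)ᴴ * D.half g = 1 ∧ D.half g * (D.half g)ᴴ = 1
  rw [← half_star, ← D.half_mul h1, ← D.half_mul (spinGroup.mem_even g.2),
    spinGroup.star_mul_self_of_mem g.2, spinGroup.mul_star_self_of_mem g.2, half_one]
  exact ⟨rfl, rfl⟩

theorem rotor_mem_mrange {a b : Fin m} (hab : a ≠ b) {c s : ℝ} (h : c ^ 2 + s ^ 2 = 1) :
    algebraMap ℝ _ c + s • (D.A (stdVec a) * D.B (stdVec b)) ∈ MonoidHom.mrange D.spinHom := by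
  refine ⟨⟨_, rotor_mem_spin hab h⟩, ?_⟩
  change D.half _ = _
  rw [map_add, half_algebraMap, map_smul, half_ι_mul_ι]

theorem star_mem_mrange {X : Matrix (Fin n) (Fin n) K} (hX : X ∈ MonoidHom.mrange D.spinHom) :
    star X ∈ MonoidHom.mrange D.spinHom := by
  obtain ⟨g, rfl⟩ := hX
  exact ⟨star g, D.half_star g⟩

/-- The abstract module and the matrix model correspond. -/
theorem action_eq {S : Type} [AddCommGroup S] [Module ℂ S] [Module ℝ S]
    [IsScalarTower ℝ ℂ S]
    (α : CliffordAlgebra (negForm m) →ₐ[ℝ] Module.End ℂ S)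
    (E O : (Fin n → K) →ₗ[ℝ] S)
    (hE : ∀ v c, α (ι _ v) (E c) = O ((D.B v).mulVec c))
    (hO : ∀ v c, α (ι _ v) (O c) = E ((D.A v).mulVec c))
    {x : CliffordAlgebra (negForm m)} (hx : x ∈ evenOdd (negForm m) 0) (c : Fin n → K) :
    α x (E c) = E ((D.half x).mulVec c) := by
  induction x, hx using even_induction with
  | algebraMap r =>
    rw [AlgHom.commutes, half_algebraMap, Module.algebraMap_end_apply,
      Algebra.algebraMap_eq_smul_one, smul_mulVec, one_mulVec, map_smul]
  | add a b ha hb iha ihb =>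
    rw [map_add, map_add, LinearMap.add_apply, iha, ihb, add_mulVec, map_add]
  | ι_mul_ι_mul v w a ha iha =>
    rw [map_mul, map_mul, Module.End.mul_apply, Module.End.mul_apply, iha, hE, hO,
      half_ι_mul_ι_mul, mulVec_mulVec, mulVec_mulVec, mul_assoc]

/-- If the half-spin representation maps onto a group of matrices that spans the matrix algebra,
and the dimensions agree, then it is an isomorphism, and it and its inverse extend linearly. -/
theorem exists_mulEquiv {m : ℕ} (D : CliffordPair (m + 1) n K) [Module.Finite ℝ K]
    (H : Submonoid (Matrix (Fin n) (Fin n) K))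
    (hdim : Module.finrank ℝ (Matrix (Fin n) (Fin n) K) = 2 ^ m)
    (hmem : ∀ g, D.spinHom g ∈ H) (hsurj : ∀ U ∈ H, U ∈ MonoidHom.mrange D.spinHom)
    (hspan : Submodule.span ℝ (H : Set (Matrix (Fin n) (Fin n) K)) = ⊤) :
    ∃ (f : Spin (m + 1) ≃* H)
      (L : Matrix (Fin n) (Fin n) K →ₗ[ℝ] CliffordAlgebra (negForm (m + 1))),
      (∀ g : Spin (m + 1), (f g : Matrix (Fin n) (Fin n) K) = D.half g) ∧
      Function.Injective L ∧ ∀ g : Spin (m + 1), L (f g) = g := by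
  let Λ := D.half ∘ₗ (evenOdd (negForm (m + 1)) 0).subtype
  -- The range is a linear subspace containing `H`, which spans.
  have hΛ : Function.Surjective Λ := by
    rw [← LinearMap.range_eq_top, eq_top_iff, ← hspan, Submodule.span_le]
    intro U hU
    obtain ⟨g, rfl⟩ := hsurj U hU
    exact ⟨⟨g, spinGroup.mem_even g.2⟩, rfl⟩
  have hΛ' : Function.Injective Λ :=
    (LinearMap.injective_iff_surjective_of_finrank_eq_finrank
      (by rw [finrank_even, hdim])).2 hΛ
  let e := LinearEquiv.ofBijective Λ ⟨hΛ', hΛ⟩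
  let φ : Spin (m + 1) →* H := D.spinHom.codRestrict H hmem
  have hφ : Function.Bijective φ := by
    constructor
    · intro g h hgh
      have h1 : Λ ⟨g, spinGroup.mem_even g.2⟩ = Λ ⟨h, spinGroup.mem_even h.2⟩ :=
        congrArg Subtype.val hgh
      exact Subtype.ext (Subtype.mk.inj (hΛ' h1))
    · rintro ⟨U, hU⟩
      obtain ⟨g, hg⟩ := hsurj U hU
      exact ⟨g, Subtype.ext hg⟩
  refine ⟨MulEquiv.ofBijective φ hφ, (evenOdd (negForm (m + 1)) 0).subtype ∘ₗ e.symm.toLinearMap,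
    fun g => rfl, Subtype.val_injective.comp e.symm.injective, fun g => ?_⟩
  exact congrArg Subtype.val (e.symm_apply_apply ⟨g, spinGroup.mem_even g.2⟩)

end CliffordPair

end SpinGroups

namespace SpinGroups

open CliffordAlgebra Matrix

/-! ### Explicit coordinates on the exterior algebras of `ℂ²` and `ℂ³` -/

/-- The generators of the exterior algebra of `ℂ^n`. -/
def gen {n : ℕ} (r : Fin n) : Spinors n := ExteriorAlgebra.ι ℂ (Pi.single r 1)

theorem ι_eq_sum_gen {n : ℕ} (w : Fin n → ℂ) :
    ExteriorAlgebra.ι ℂ w = ∑ r, w r • gen r := by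
  conv_lhs => rw [pi_eq_sum_univ' w]
  simp [gen, map_sum]

theorem gen_mul_self {n : ℕ} (r : Fin n) : gen r * gen r = 0 := ExteriorAlgebra.ι_sq_zero _

theorem gen_mul_gen {n : ℕ} (r s : Fin n) : gen r * gen s = -(gen s * gen r) :=
  eq_neg_of_add_eq_zero_left (ExteriorAlgebra.ι_add_mul_swap _ _)

theorem gen_mul_gen_mul_self {n : ℕ} (r : Fin n) (x : Spinors n) : gen r * (gen r * x) = 0 := by
  rw [← mul_assoc, gen_mul_self, zero_mul]

theorem gen_mul_gen_mul {n : ℕ} (r s : Fin n) (x : Spinors n) :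
    gen r * (gen s * x) = -(gen s * (gen r * x)) := by
  rw [← mul_assoc, gen_mul_gen, neg_mul, mul_assoc]

/-- Contraction with the functional `⟨w, ·⟩`. -/
theorem annihilation_gen_mul {n : ℕ} (w : Fin n → ℂ) (r : Fin n) (x : Spinors n) :
    annihilation w (gen r * x) = starRingEnd ℂ (w r) • x - gen r * annihilation w x := by
  have h : hermDual w (Pi.single r 1) = starRingEnd ℂ (w r) := by
    simp [hermDual_apply, Pi.single_apply]
  rw [← h]
  exact contractLeft_ι_mul (Q := (0 : QuadraticForm ℂ (Fin n → ℂ))) (hermDual w) _ x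

theorem annihilation_gen {n : ℕ} (w : Fin n → ℂ) (r : Fin n) :
    annihilation w (gen r) = starRingEnd ℂ (w r) • 1 := by
  have h : hermDual w (Pi.single r 1) = starRingEnd ℂ (w r) := by
    simp [hermDual_apply, Pi.single_apply]
  rw [← h, ← Algebra.algebraMap_eq_smul_one]
  exact contractLeft_ι (Q := (0 : QuadraticForm ℂ (Fin n → ℂ))) (hermDual w) _

theorem annihilation_one {n : ℕ} (w : Fin n → ℂ) : annihilation w (1 : Spinors n) = 0 :=
  contractLeft_one (Q := (0 : QuadraticForm ℂ (Fin n → ℂ))) (hermDual w)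

theorem gen_mem_oddSpinors {n : ℕ} (r : Fin n) : gen r ∈ oddSpinors n := ι_mem_evenOdd_one _ _

theorem gen_mul_gen_mem_evenSpinors {n : ℕ} (r s : Fin n) : gen r * gen s ∈ evenSpinors n :=
  ι_mul_ι_mem_evenOdd_zero _ _ _

/-- The spinor on `ℂ²` with given coordinates. -/
def spinor₂ : (Fin 4 → ℂ) →ₗ[ℂ] Spinors 2 where
  toFun c := c 0 • 1 + c 1 • gen 0 + c 2 • gen 1 + c 3 • (gen 0 * gen 1)
  map_add' c d := by simp only [Pi.add_apply]; module
  map_smul' t c := by simp only [Pi.smul_apply, smul_eq_mul, RingHom.id_apply]; module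

theorem spinor₂_apply (c : Fin 4 → ℂ) :
    spinor₂ c = c 0 • 1 + c 1 • gen 0 + c 2 • gen 1 + c 3 • (gen 0 * gen 1) := rfl

/-- The even spinor on `ℂ³` with given coordinates. -/
def evenSpinor₃ : (Fin 4 → ℂ) →ₗ[ℂ] Spinors 3 where
  toFun c := c 0 • 1 + c 1 • (gen 0 * gen 1) + c 2 • (gen 0 * gen 2) + c 3 • (gen 1 * gen 2)
  map_add' c d := by simp only [Pi.add_apply]; module
  map_smul' t c := by simp only [Pi.smul_apply, smul_eq_mul, RingHom.id_apply]; module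

theorem evenSpinor₃_apply (c : Fin 4 → ℂ) : evenSpinor₃ c =
    c 0 • 1 + c 1 • (gen 0 * gen 1) + c 2 • (gen 0 * gen 2) + c 3 • (gen 1 * gen 2) := rfl

/-- The odd spinor on `ℂ³` with given coordinates. -/
def oddSpinor₃ : (Fin 4 → ℂ) →ₗ[ℂ] Spinors 3 where
  toFun c := c 0 • gen 0 + c 1 • gen 1 + c 2 • gen 2 + c 3 • (gen 0 * (gen 1 * gen 2))
  map_add' c d := by simp only [Pi.add_apply]; module
  map_smul' t c := by simp only [Pi.smul_apply, smul_eq_mul, RingHom.id_apply]; module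

theorem oddSpinor₃_apply (c : Fin 4 → ℂ) : oddSpinor₃ c =
    c 0 • gen 0 + c 1 • gen 1 + c 2 • gen 2 + c 3 • (gen 0 * (gen 1 * gen 2)) := rfl

/-- In this and the following computations the generators are brought into increasing order by
anticommutation; the explicit indices name the transpositions that occur. -/
theorem ι_mul_spinor₂ (w : Fin 2 → ℂ) (c : Fin 4 → ℂ) :
    ExteriorAlgebra.ι ℂ w * spinor₂ c =
      spinor₂ ![0, w 0 * c 0, w 1 * c 0, w 0 * c 2 - w 1 * c 1] := by
  simp only [ι_eq_sum_gen, Fin.sum_univ_two, spinor₂_apply, add_mul, mul_add, smul_mul_assoc,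
    mul_smul_comm, mul_one, gen_mul_self, gen_mul_gen_mul_self, gen_mul_gen 1 0,
    gen_mul_gen_mul 1 0]
  simp
  module

theorem annihilation_spinor₂ (w : Fin 2 → ℂ) (c : Fin 4 → ℂ) :
    annihilation w (spinor₂ c) =
      spinor₂ ![starRingEnd ℂ (w 0) * c 1 + starRingEnd ℂ (w 1) * c 2,
        -(starRingEnd ℂ (w 1) * c 3), starRingEnd ℂ (w 0) * c 3, 0] := by
  simp only [spinor₂_apply, map_add, map_smul, annihilation_gen_mul, annihilation_gen,
    annihilation_one, mul_smul_comm, mul_one]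
  simp
  module

theorem ι_mul_evenSpinor₃ (w : Fin 3 → ℂ) (c : Fin 4 → ℂ) :
    ExteriorAlgebra.ι ℂ w * evenSpinor₃ c =
      oddSpinor₃ ![w 0 * c 0, w 1 * c 0, w 2 * c 0, w 0 * c 3 - w 1 * c 2 + w 2 * c 1] := by
  simp only [ι_eq_sum_gen, Fin.sum_univ_three, evenSpinor₃_apply, oddSpinor₃_apply, add_mul,
    mul_add, smul_mul_assoc, mul_smul_comm, mul_one, gen_mul_self, gen_mul_gen_mul_self,
    gen_mul_gen 2 1,
    gen_mul_gen_mul 1 0, gen_mul_gen_mul 2 0, gen_mul_gen_mul 2 1, mul_neg, mul_zero]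
  simp
  module

theorem ι_mul_oddSpinor₃ (w : Fin 3 → ℂ) (c : Fin 4 → ℂ) :
    ExteriorAlgebra.ι ℂ w * oddSpinor₃ c =
      evenSpinor₃ ![0, w 0 * c 1 - w 1 * c 0, w 0 * c 2 - w 2 * c 0, w 1 * c 2 - w 2 * c 1] := by
  simp only [ι_eq_sum_gen, Fin.sum_univ_three, evenSpinor₃_apply, oddSpinor₃_apply, add_mul,
    mul_add, smul_mul_assoc, mul_smul_comm, gen_mul_self, gen_mul_gen_mul_self,
    gen_mul_gen 1 0, gen_mul_gen 2 0, gen_mul_gen 2 1,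
    gen_mul_gen_mul 1 0, gen_mul_gen_mul 2 0, gen_mul_gen_mul 2 1, mul_neg, mul_zero]
  simp
  module

theorem annihilation_evenSpinor₃ (w : Fin 3 → ℂ) (c : Fin 4 → ℂ) :
    annihilation w (evenSpinor₃ c) =
      oddSpinor₃ ![-(starRingEnd ℂ (w 1) * c 1) - starRingEnd ℂ (w 2) * c 2,
        starRingEnd ℂ (w 0) * c 1 - starRingEnd ℂ (w 2) * c 3,
        starRingEnd ℂ (w 0) * c 2 + starRingEnd ℂ (w 1) * c 3, 0] := by
  simp only [evenSpinor₃_apply, oddSpinor₃_apply, map_add, map_smul, annihilation_gen_mul,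
    annihilation_gen, annihilation_one, mul_smul_comm, mul_one]
  simp
  module

theorem annihilation_oddSpinor₃ (w : Fin 3 → ℂ) (c : Fin 4 → ℂ) :
    annihilation w (oddSpinor₃ c) =
      evenSpinor₃ ![starRingEnd ℂ (w 0) * c 0 + starRingEnd ℂ (w 1) * c 1 +
        starRingEnd ℂ (w 2) * c 2, starRingEnd ℂ (w 2) * c 3, -(starRingEnd ℂ (w 1) * c 3),
        starRingEnd ℂ (w 0) * c 3] := by
  simp only [evenSpinor₃_apply, oddSpinor₃_apply, map_add, map_smul, annihilation_gen_mul,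
    annihilation_gen, mul_smul_comm, mul_one, mul_sub]
  simp
  module

/-- The exterior algebra is built from `1` by left multiplication with vectors and sums. This yields
surjectivity of the coordinate maps, and a dimension count then gives injectivity. -/
theorem eq_top_of_ι_mul_mem {n : ℕ} {W : Submodule ℂ (Spinors n)} (h1 : 1 ∈ W)
    (hmul : ∀ w, ∀ x ∈ W, ExteriorAlgebra.ι ℂ w * x ∈ W) : W = ⊤ := by
  refine eq_top_iff.2 fun x _ => ?_
  induction x using CliffordAlgebra.left_induction with
  | algebraMap r =>
    rw [Algebra.algebraMap_eq_smul_one]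
    exact W.smul_mem _ h1
  | add x y hx hy => exact W.add_mem (hx trivial) (hy trivial)
  | ι_mul x m hx => exact hmul _ _ (hx trivial)

theorem spinor₂_bijective : Function.Bijective spinor₂ := by
  have hs : Function.Surjective spinor₂ := by
    rw [← LinearMap.range_eq_top]
    refine eq_top_of_ι_mul_mem ⟨![1, 0, 0, 0], by simp [spinor₂_apply]⟩ ?_
    rintro w _ ⟨c, rfl⟩
    exact ⟨_, (ι_mul_spinor₂ w c).symm⟩
  refine ⟨(LinearMap.injective_iff_surjective_of_finrank_eq_finrank ?_).2 hs, hs⟩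
  rw [finrank_exteriorAlgebra]
  simp

theorem evenSpinor₃_mem (c : Fin 4 → ℂ) : evenSpinor₃ c ∈ evenSpinors 3 := by
  rw [evenSpinor₃_apply]
  have h1 : (1 : Spinors 3) ∈ evenSpinors 3 := Submodule.one_le.1 (one_le_evenOdd_zero _)
  exact add_mem (add_mem (add_mem (Submodule.smul_mem _ _ h1)
    (Submodule.smul_mem _ _ (gen_mul_gen_mem_evenSpinors _ _)))
    (Submodule.smul_mem _ _ (gen_mul_gen_mem_evenSpinors _ _)))
    (Submodule.smul_mem _ _ (gen_mul_gen_mem_evenSpinors _ _))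

theorem oddSpinor₃_mem (c : Fin 4 → ℂ) : oddSpinor₃ c ∈ oddSpinors 3 := by
  rw [oddSpinor₃_apply]
  have h1 : gen 0 * (gen 1 * gen 2) ∈ oddSpinors 3 :=
    evenOdd_mul_le _ 1 0 (Submodule.mul_mem_mul (gen_mem_oddSpinors 0)
      (gen_mul_gen_mem_evenSpinors 1 2))
  exact add_mem (add_mem (add_mem (Submodule.smul_mem _ _ (gen_mem_oddSpinors _))
    (Submodule.smul_mem _ _ (gen_mem_oddSpinors _)))
    (Submodule.smul_mem _ _ (gen_mem_oddSpinors _))) (Submodule.smul_mem _ _ h1)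

/-- The even and odd coordinates are treated together because multiplication by a vector exchanges
them, so only the joint range is stable; the dimensions are `4 + 4 = 2^3`. -/
theorem coprod_evenSpinor₃_oddSpinor₃_bijective :
    Function.Bijective (evenSpinor₃.coprod oddSpinor₃) := by
  have hs : Function.Surjective (evenSpinor₃.coprod oddSpinor₃) := by
    rw [← LinearMap.range_eq_top]
    refine eq_top_of_ι_mul_mem ⟨(![1, 0, 0, 0], 0), by simp [evenSpinor₃_apply]⟩ ?_
    rintro w _ ⟨⟨c, d⟩, rfl⟩
    rw [LinearMap.coprod_apply, mul_add, ι_mul_evenSpinor₃, ι_mul_oddSpinor₃]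
    exact ⟨(_, _), (LinearMap.coprod_apply _ _ _).trans (add_comm _ _)⟩
  refine ⟨(LinearMap.injective_iff_surjective_of_finrank_eq_finrank ?_).2 hs, hs⟩
  rw [finrank_exteriorAlgebra]
  simp

/-- Coordinates on the even part of the exterior algebra of `ℂ³`. -/
noncomputable def evenSpinorEquiv : (Fin 4 → ℂ) ≃ₗ[ℂ] evenSpinors 3 := by
  refine LinearEquiv.ofBijective (evenSpinor₃.codRestrict _ evenSpinor₃_mem) ⟨?_, ?_⟩
  · intro c d h
    have h1 : evenSpinor₃ c = evenSpinor₃ d := congrArg Subtype.val h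
    have h2 := coprod_evenSpinor₃_oddSpinor₃_bijective.1 (a₁ := (c, 0)) (a₂ := (d, 0))
      (by simp [h1])
    exact congrArg Prod.fst h2
  · rintro ⟨x, hx⟩
    obtain ⟨⟨c, d⟩, rfl⟩ := coprod_evenSpinor₃_oddSpinor₃_bijective.2 x
    refine ⟨c, Subtype.ext ?_⟩
    -- The odd component of an even spinor is both even and odd, hence zero.
    have h1 : oddSpinor₃ d ∈ evenSpinors 3 := by
      have := sub_mem hx (evenSpinor₃_mem c)
      simpa using this
    have h2 : oddSpinor₃ d = 0 :=
      Submodule.disjoint_def.1 (evenOdd_isCompl (0 : QuadraticForm ℂ (Fin 3 → ℂ))).disjoint _ h1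
        (oddSpinor₃_mem d)
    simp [h2]

end SpinGroups

namespace SpinGroups

open CliffordAlgebra Matrix

/-! ### Polar decompositions -/

/-- The half angle: a product of two rotors of the same angle acts on one coordinate by a square, so
a given phase needs a square root. -/
theorem exists_unit_sq_eq {z : ℂ} (hz : ‖z‖ = 1) :
    ∃ c s : ℝ, c ^ 2 + s ^ 2 = 1 ∧ z = (c + s * Complex.I) ^ 2 := by
  obtain ⟨w, hw⟩ := IsAlgClosed.exists_pow_nat_eq z (n := 2) (by norm_num)
  have h1 : ‖w‖ ^ 2 = 1 := by rw [← norm_pow, hw, hz]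
  refine ⟨w.re, w.im, ?_, ?_⟩
  · rw [← h1, ← Complex.normSq_eq_norm_sq, Complex.normSq_apply]
    ring
  · rw [Complex.re_add_im, hw]

theorem exists_eq_norm_mul_unit (z : ℂ) : ∃ u : ℂ, ‖u‖ = 1 ∧ z = ‖z‖ * u := by
  by_cases hz : z = 0
  · exact ⟨1, by simp, by simp [hz]⟩
  · have h : (‖z‖ : ℂ) ≠ 0 := by simpa using hz
    refine ⟨z / ‖z‖, by simp [hz], by field_simp⟩

/-- Every real multiple of an element of `SU(2)`, with first row `(x, y)`, is a product of a
diagonal matrix, a real matrix and a diagonal matrix. -/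
theorem exists_phase_rotation_phase (x y : ℂ) :
    ∃ p q : ℂ, ‖p‖ = 1 ∧ ‖q‖ = 1 ∧ x = ‖x‖ * p * q ∧
      y = ‖y‖ * p * starRingEnd ℂ q := by
  obtain ⟨u, hu, hxu⟩ := exists_eq_norm_mul_unit x
  obtain ⟨v, hv, hyv⟩ := exists_eq_norm_mul_unit y
  -- With `u`, `v` the phases of `x`, `y`, the equations `pq = u` and `p q̄ = v` force `p² = uv` and
  -- `q = u p̄`.
  obtain ⟨p, hp⟩ := IsAlgClosed.exists_pow_nat_eq (u * v) (n := 2) (by norm_num)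
  have hp1 : ‖p‖ = 1 := by
    have : ‖p‖ ^ 2 = 1 := by rw [← norm_pow, hp, norm_mul, hu, hv, one_mul]
    nlinarith [norm_nonneg p]
  have hpp : p * starRingEnd ℂ p = 1 := by
    rw [Complex.mul_conj, Complex.normSq_eq_norm_sq, hp1]; simp
  have huu : u * starRingEnd ℂ u = 1 := by
    rw [Complex.mul_conj, Complex.normSq_eq_norm_sq, hu]; simp
  refine ⟨p, u * starRingEnd ℂ p, hp1, by simp [hu, hp1], ?_, ?_⟩
  · linear_combination hxu - ‖x‖ * u * hpp
  · rw [map_mul, Complex.conj_conj]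
    linear_combination hyv - ‖y‖ * starRingEnd ℂ u * hp - ‖y‖ * v * huu

theorem exists_eq_norm_smul_unit (q : ℍ) : ∃ u : ℍ, ‖u‖ = 1 ∧ q = ‖q‖ • u := by
  by_cases hq : q = 0
  · exact ⟨1, by simp, by simp [hq]⟩
  · have h : ‖q‖ ≠ 0 := by simpa using hq
    exact ⟨‖q‖⁻¹ • q, by simp [norm_smul, h], by simp [smul_smul, h]⟩

theorem star_mul_self_of_norm {u : ℍ} (hu : ‖u‖ = 1) : star u * u = 1 := by
  rw [Quaternion.star_mul_self, Quaternion.normSq_eq_norm_mul_self, hu]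
  simp

/-! ### The vectors of `ℝ⁵` as traceless Hermitian quaternionic matrices -/

/-- The quaternion with which the first four coordinates act. -/
noncomputable def vecQuaternion (v : Fin 5 → ℝ) : ℍ := ⟨-v 1, v 0, v 3, -v 2⟩

@[simp] theorem re_vecQuaternion (v : Fin 5 → ℝ) : (vecQuaternion v).re = -v 1 := rfl

@[simp] theorem imI_vecQuaternion (v : Fin 5 → ℝ) : (vecQuaternion v).imI = v 0 := rfl

@[simp] theorem imJ_vecQuaternion (v : Fin 5 → ℝ) : (vecQuaternion v).imJ = v 3 := rfl

@[simp] theorem imK_vecQuaternion (v : Fin 5 → ℝ) : (vecQuaternion v).imK = -v 2 := rfl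

/-- The vectors of `ℝ⁵` as traceless Hermitian quaternionic matrices. -/
noncomputable def hermMatrix : (Fin 5 → ℝ) →ₗ[ℝ] Matrix (Fin 2) (Fin 2) ℍ where
  toFun v := !![(v 4 : ℍ), vecQuaternion v; star (vecQuaternion v), -(v 4 : ℍ)]
  map_add' v w := by
    ext i j <;> fin_cases i <;> fin_cases j <;> simp <;> ring
  map_smul' t v := by
    ext i j <;> fin_cases i <;> fin_cases j <;> simp

theorem hermMatrix_apply (v : Fin 5 → ℝ) :
    hermMatrix v = !![(v 4 : ℍ), vecQuaternion v; star (vecQuaternion v), -(v 4 : ℍ)] := rfl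

theorem hermMatrix_mul_self (v : Fin 5 → ℝ) :
    hermMatrix v * hermMatrix v = -algebraMap ℝ _ (negForm 5 v) := by
  rw [negForm_apply, algebraMap_eq_diagonal]
  ext i j <;> fin_cases i <;> fin_cases j <;>
    simp [hermMatrix_apply, Matrix.mul_apply, Fin.sum_univ_succ] <;> ring

theorem conjTranspose_hermMatrix (v : Fin 5 → ℝ) : (hermMatrix v)ᴴ = hermMatrix v := by
  ext i j <;> fin_cases i <;> fin_cases j <;> simp [hermMatrix_apply]

/-- The action of vectors of `ℝ⁵` in quaternionic form. -/
noncomputable def quaternionicPair : CliffordPair 5 2 ℍ where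
  A := hermMatrix
  B := -hermMatrix
  A_mul_B v := by simp [hermMatrix_mul_self]
  B_mul_A v := by simp [hermMatrix_mul_self]
  conjTranspose_A v := by simp [conjTranspose_hermMatrix]
  star_algebraMap r := Quaternion.star_coe r

theorem finrank_quaternionMatrix : Module.finrank ℝ (Matrix (Fin 2) (Fin 2) ℍ) = 2 ^ 4 := by
  rw [Module.finrank_matrix, Quaternion.finrank_eq_four]
  simp

/-- The submonoid of matrices coming from `Spin(5)`. -/
noncomputable abbrev spinImage₅ : Submonoid (Matrix (Fin 2) (Fin 2) ℍ) := MonoidHom.mrange quaternionicPair.spinHom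

theorem rotation_mem_spinImage₅ {c s : ℝ} (h : c ^ 2 + s ^ 2 = 1) :
    !![(c : ℍ), -(s : ℍ); (s : ℍ), (c : ℍ)] ∈ spinImage₅ := by
  convert quaternionicPair.rotor_mem_mrange (a := 1) (b := 4) (by decide) h using 1
  rw [algebraMap_eq_diagonal]
  ext i j <;> fin_cases i <;> fin_cases j <;>
    simp [quaternionicPair, hermMatrix_apply, stdVec]

theorem diagonal_i_mem_spinImage₅ {c s : ℝ} (h : c ^ 2 + s ^ 2 = 1) :
    !![((c + s * Complex.I : ℂ) : ℍ), 0; 0, ((c - s * Complex.I : ℂ) : ℍ)] ∈ spinImage₅ := by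
  convert quaternionicPair.rotor_mem_mrange (a := 0) (b := 1) (by decide) h using 1
  rw [algebraMap_eq_diagonal]
  ext i j <;> fin_cases i <;> fin_cases j <;>
    simp [quaternionicPair, hermMatrix_apply, stdVec]

theorem diagonal_i_mem_spinImage₅' {c s : ℝ} (h : c ^ 2 + s ^ 2 = 1) :
    !![((c + s * Complex.I : ℂ) : ℍ), 0; 0, ((c + s * Complex.I : ℂ) : ℍ)] ∈ spinImage₅ := by
  convert quaternionicPair.rotor_mem_mrange (a := 2) (b := 3) (by decide) h using 1
  rw [algebraMap_eq_diagonal]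
  ext i j <;> fin_cases i <;> fin_cases j <;>
    simp [quaternionicPair, hermMatrix_apply, stdVec]

/-- The quaternion `c + s j`. -/
def quaternionJ (c s : ℝ) : ℍ := ⟨c, 0, s, 0⟩

@[simp] theorem re_quaternionJ (c s : ℝ) : (quaternionJ c s).re = c := rfl

@[simp] theorem imI_quaternionJ (c s : ℝ) : (quaternionJ c s).imI = 0 := rfl

@[simp] theorem imJ_quaternionJ (c s : ℝ) : (quaternionJ c s).imJ = s := rfl

@[simp] theorem imK_quaternionJ (c s : ℝ) : (quaternionJ c s).imK = 0 := rfl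

theorem diagonal_j_mem_spinImage₅ {c s : ℝ} (h : c ^ 2 + s ^ 2 = 1) :
    !![quaternionJ c s, 0; 0, quaternionJ c (-s)] ∈ spinImage₅ := by
  have h' : c ^ 2 + (-s) ^ 2 = 1 := by rwa [neg_sq]
  convert quaternionicPair.rotor_mem_mrange (a := 1) (b := 3) (by decide) h' using 1
  rw [algebraMap_eq_diagonal]
  ext i j <;> fin_cases i <;> fin_cases j <;>
    simp [quaternionicPair, hermMatrix_apply, stdVec]

theorem diagonal_j_mem_spinImage₅' {c s : ℝ} (h : c ^ 2 + s ^ 2 = 1) :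
    !![quaternionJ c s, 0; 0, quaternionJ c s] ∈ spinImage₅ := by
  convert quaternionicPair.rotor_mem_mrange (a := 0) (b := 2) (by decide) h using 1
  rw [algebraMap_eq_diagonal]
  ext i j <;> fin_cases i <;> fin_cases j <;>
    simp [quaternionicPair, hermMatrix_apply, stdVec]

theorem ofReal_sq_add_sq {c s : ℝ} (h : c ^ 2 + s ^ 2 = 1) : (c : ℂ) ^ 2 + (s : ℂ) ^ 2 = 1 := by
  exact_mod_cast h

/-- Products of commuting rotors give the phases in a single quaternionic coordinate. -/
theorem diagonal_phase_mem_spinImage₅ {z : ℂ} (hz : ‖z‖ = 1) :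
    !![(z : ℍ), 0; 0, 1] ∈ spinImage₅ ∧ !![1, 0; 0, (z : ℍ)] ∈ spinImage₅ := by
  obtain ⟨c, s, h, rfl⟩ := exists_unit_sq_eq hz
  have h' : c ^ 2 + (-s) ^ 2 = 1 := by rwa [neg_sq]
  have h1 : ((c - s * Complex.I : ℂ) : ℍ) * ((c + s * Complex.I : ℂ) : ℍ) = 1 := by
    rw [← Quaternion.coeComplex_mul, ← Quaternion.coeComplex_one]
    congr 1
    linear_combination ofReal_sq_add_sq h - s ^ 2 * Complex.I_sq
  constructor
  · convert mul_mem (diagonal_i_mem_spinImage₅ h) (diagonal_i_mem_spinImage₅' h) using 1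
    rw [Matrix.mul_fin_two, h1, sq, Quaternion.coeComplex_mul]
    simp
  · convert mul_mem (diagonal_i_mem_spinImage₅ h') (diagonal_i_mem_spinImage₅' h) using 1
    rw [Matrix.mul_fin_two]
    simp only [Complex.ofReal_neg, neg_mul, sub_neg_eq_add, ← sub_eq_add_neg]
    rw [h1, sq, Quaternion.coeComplex_mul]
    simp

/-- The cancellation used for phases, with `j` in place of `i`: if `q` is the half-angle quaternion,
then `diag(q, q̄) diag(q, q) = diag(q², 1)`, and `diag(q̄, q) diag(q, q) = diag(1, q²)`. -/
theorem diagonal_rotation_mem_spinImage₅ {c s : ℝ} (h : c ^ 2 + s ^ 2 = 1) :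
    !![quaternionJ c s, 0; 0, 1] ∈ spinImage₅ ∧
      !![1, 0; 0, quaternionJ c s] ∈ spinImage₅ := by
  have hz : ‖(⟨c, s⟩ : ℂ)‖ = 1 := by
    rw [Complex.norm_def, Complex.normSq_mk, ← sq, ← sq, h, Real.sqrt_one]
  obtain ⟨d, t, hd, hdt⟩ := exists_unit_sq_eq hz
  have hd' : d ^ 2 + (-t) ^ 2 = 1 := by rwa [neg_sq]
  have hc : c = d * d - t * t := by simpa [sq] using congrArg Complex.re hdt
  have hs : s = d * t + t * d := by simpa [sq] using congrArg Complex.im hdt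
  have h1 : quaternionJ d (-t) * quaternionJ d t = 1 := by
    ext <;> simp <;> linarith
  have h2 : quaternionJ d t * quaternionJ d t = quaternionJ c s := by
    ext <;> simp <;> linarith
  constructor
  · convert mul_mem (diagonal_j_mem_spinImage₅ hd) (diagonal_j_mem_spinImage₅' hd) using 1
    rw [Matrix.mul_fin_two, h1, h2]
    simp
  · convert mul_mem (diagonal_j_mem_spinImage₅ hd') (diagonal_j_mem_spinImage₅' hd) using 1
    rw [Matrix.mul_fin_two, h1, neg_neg, h2]
    simp

/-- Write `q = x + y j` with `x`, `y` complex. Since `j r = r̄ j`, the product `p (c + s j) r` is `c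
p r + s p r̄ j`, which is the decomposition of `exists_phase_rotation_phase`. -/
theorem exists_quaternion_eq_mul {q : ℍ} (hq : ‖q‖ = 1) :
    ∃ (p r : ℂ) (c s : ℝ), ‖p‖ = 1 ∧ ‖r‖ = 1 ∧ c ^ 2 + s ^ 2 = 1 ∧
      q = (p : ℍ) * quaternionJ c s * (r : ℍ) := by
  obtain ⟨p, r, hp, hr, hx, hy⟩ := exists_phase_rotation_phase ⟨q.re, q.imI⟩ ⟨q.imJ, q.imK⟩
  set c := ‖(⟨q.re, q.imI⟩ : ℂ)‖ with hc
  set s := ‖(⟨q.imJ, q.imK⟩ : ℂ)‖ with hs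
  refine ⟨p, r, c, s, hp, hr, ?_, ?_⟩
  · rw [hc, hs, ← Complex.normSq_eq_norm_sq, ← Complex.normSq_eq_norm_sq, Complex.normSq_mk,
      Complex.normSq_mk]
    have := Quaternion.normSq_eq_norm_mul_self q
    rw [hq, Quaternion.normSq_def'] at this
    linarith
  · have h1 := congrArg Complex.re hx
    have h2 := congrArg Complex.im hx
    have h3 := congrArg Complex.re hy
    have h4 := congrArg Complex.im hy
    simp at h1 h2 h3 h4
    ext <;> simp
    · linarith
    · linarith
    · linarith
    · linarith

theorem diagonal_mem_spinImage₅ {u v : ℍ} (hu : ‖u‖ = 1) (hv : ‖v‖ = 1) :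
    !![u, 0; 0, v] ∈ spinImage₅ := by
  obtain ⟨p, r, c, s, hp, hr, h, rfl⟩ := exists_quaternion_eq_mul hu
  obtain ⟨p', r', c', s', hp', hr', h', rfl⟩ := exists_quaternion_eq_mul hv
  convert mul_mem (mul_mem (mul_mem (diagonal_phase_mem_spinImage₅ hp).1
    (diagonal_rotation_mem_spinImage₅ h).1) (diagonal_phase_mem_spinImage₅ hr).1)
    (mul_mem (mul_mem (diagonal_phase_mem_spinImage₅ hp').2
    (diagonal_rotation_mem_spinImage₅ h').2) (diagonal_phase_mem_spinImage₅ hr').2) using 1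
  simp

end SpinGroups

/-! ### `Sp(2)` is the image of `Spin(5)` and spans the quaternionic matrices -/

namespace SpinGroups

open CliffordAlgebra Matrix

theorem mem_Sp_iff {U : Matrix (Fin 2) (Fin 2) ℍ} : U ∈ Sp 2 ↔ Uᴴ * U = 1 ∧ U * Uᴴ = 1 :=
  Unitary.mem_iff

/-- Cancels a unitary factor inside a submonoid, its adjoint serving as inverse: `U = X* (X U)`. -/
theorem mem_of_mul_mem {n : ℕ} {K : Type} [Ring K] [StarRing K]
    {H : Submonoid (Matrix (Fin n) (Fin n) K)} {X U : Matrix (Fin n) (Fin n) K}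
    (hstar : star X ∈ H) (hX : X ∈ unitary (Matrix (Fin n) (Fin n) K)) (h : X * U ∈ H) :
    U ∈ H := by
  have := mul_mem hstar h
  rwa [← mul_assoc, (Unitary.mem_iff.1 hX).1, one_mul] at this

theorem spinImage₅_le_Sp {X : Matrix (Fin 2) (Fin 2) ℍ} (hX : X ∈ spinImage₅) : X ∈ Sp 2 := by
  obtain ⟨g, rfl⟩ := hX
  exact quaternionicPair.spinHom_mem_unitary g

theorem quaternion_norm_one {d : ℍ} (h : d * star d = 1) : ‖d‖ = 1 := by
  have h1 : ‖d‖ * ‖d‖ = 1 := by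
    rw [← CStarRing.norm_self_mul_star (x := d), h, norm_one]
  nlinarith [norm_nonneg d]

/-- A diagonal element makes the first column real and nonnegative, equal to `(c, s)` with `c² + s²
= 1`, and a real rotation sends it to `(1, 0)`. Unitarity then leaves `diag(1, w)` with `w` a unit
quaternion. -/
theorem mem_spinImage₅_of_mem_Sp {U : Matrix (Fin 2) (Fin 2) ℍ} (hU : U ∈ Sp 2) :
    U ∈ spinImage₅ := by
  obtain ⟨u, hu, hau⟩ := exists_eq_norm_smul_unit (U 0 0)
  obtain ⟨v, hv, hcv⟩ := exists_eq_norm_smul_unit (U 1 0)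
  set c := ‖U 0 0‖
  set s := ‖U 1 0‖
  have hD := diagonal_mem_spinImage₅ (u := star u) (v := star v) (by simpa) (by simpa)
  have hcs : c ^ 2 + s ^ 2 = 1 := by
    have h := congrFun (congrFun (mem_Sp_iff.1 hU).1 0) 0
    simp only [Matrix.mul_apply, Fin.sum_univ_two, conjTranspose_apply, one_apply_eq,
      Quaternion.star_mul_self, ← Quaternion.coe_add] at h
    have h2 := congrArg (·.re) h
    simp only [Quaternion.re_coe, Quaternion.re_one, Quaternion.normSq_eq_norm_mul_self] at h2
    linarith
  -- The angle is negated so that the rotation takes the column `(c, s)` to `(1, 0)`.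
  have hR := rotation_mem_spinImage₅ (c := c) (s := -s) (by rwa [neg_sq])
  have hRD := mul_mem hR hD
  refine mem_of_mul_mem (quaternionicPair.star_mem_mrange hRD) (spinImage₅_le_Sp hRD) ?_
  have hV := mul_mem (spinImage₅_le_Sp hRD) hU
  set V := !![(c : ℍ), -((-s : ℝ) : ℍ); ((-s : ℝ) : ℍ), (c : ℍ)] *
    !![star u, 0; 0, star v] * U with hVdef
  have hu1 : star u * U 0 0 = (c : ℍ) := by
    rw [hau, mul_smul_comm, star_mul_self_of_norm hu]
    exact (Quaternion.coe_mul_eq_smul c 1).symm.trans (mul_one _)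
  have hv1 : star v * U 1 0 = (s : ℍ) := by
    rw [hcv, mul_smul_comm, star_mul_self_of_norm hv]
    exact (Quaternion.coe_mul_eq_smul s 1).symm.trans (mul_one _)
  have hV00 : V 0 0 = 1 := by
    have h1 : V 0 0 = (c : ℍ) * (star u * U 0 0) + (s : ℍ) * (star v * U 1 0) := by
      simp [hVdef, vecMul, dotProduct, Fin.sum_univ_two, mul_assoc]
    rw [h1, hu1, hv1, ← Quaternion.coe_mul, ← Quaternion.coe_mul, ← Quaternion.coe_add,
      ← sq, ← sq, hcs, Quaternion.coe_one]
  have hV10 : V 1 0 = 0 := by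
    have h1 : V 1 0 = -(s : ℍ) * (star u * U 0 0) + (c : ℍ) * (star v * U 1 0) := by
      simp [hVdef, vecMul, dotProduct, Fin.sum_univ_two, mul_assoc]
    rw [h1, hu1, hv1, neg_mul, ← Quaternion.coe_mul, ← Quaternion.coe_mul, mul_comm, neg_add_cancel]
  obtain ⟨h1, h2⟩ := mem_Sp_iff.1 hV
  have hV01 : V 0 1 = 0 := by
    have h := congrFun (congrFun h1 0) 1
    simpa [Matrix.mul_apply, Fin.sum_univ_two, hV00, hV10] using h
  have hV11 : V 1 1 * star (V 1 1) = 1 := by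
    have h := congrFun (congrFun h2 1) 1
    simpa [Matrix.mul_apply, Fin.sum_univ_two, hV00, hV10, hV01] using h
  have hVeq : V = !![1, 0; 0, V 1 1] := by
    ext i j : 1
    fin_cases i <;> fin_cases j <;> simp [hV00, hV10, hV01]
  rw [hVeq]
  exact diagonal_mem_spinImage₅ norm_one (quaternion_norm_one hV11)

theorem diagonal_mem_Sp {u v : ℍ} (hu : ‖u‖ = 1) (hv : ‖v‖ = 1) : !![u, 0; 0, v] ∈ Sp 2 :=
  spinImage₅_le_Sp (diagonal_mem_spinImage₅ hu hv)

theorem antidiagonal_mem_Sp {u v : ℍ} (hu : ‖u‖ = 1) (hv : ‖v‖ = 1) : !![0, u; v, 0] ∈ Sp 2 := by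
  have h := mul_mem (diagonal_mem_Sp (u := -u) (v := v) (by simpa) hv)
    (spinImage₅_le_Sp (rotation_mem_spinImage₅ (c := 0) (s := 1) (by norm_num)))
  simpa [Matrix.mul_fin_two] using h

/-- A matrix with a single unit entry is half the sum or difference of two elements of `Sp(2)`, both
diagonal or both antidiagonal, that differ in one sign. Every matrix is a real combination of such
single-entry matrices. -/
theorem span_Sp : Submodule.span ℝ (Sp 2 : Set (Matrix (Fin 2) (Fin 2) ℍ)) = ⊤ := by
  refine eq_top_iff.2 fun X _ => ?_
  set W := Submodule.span ℝ (Sp 2 : Set (Matrix (Fin 2) (Fin 2) ℍ))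
  have key : ∀ Y Z : Matrix (Fin 2) (Fin 2) ℍ, Y + Z ∈ Sp 2 → Y - Z ∈ Sp 2 →
      Y ∈ W ∧ Z ∈ W := by
    intro Y Z h1 h2
    have h3 : Y = (2⁻¹ : ℝ) • (Y + Z) + (2⁻¹ : ℝ) • (Y - Z) := by module
    have h4 : Z = (2⁻¹ : ℝ) • (Y + Z) - (2⁻¹ : ℝ) • (Y - Z) := by module
    have h5 := W.smul_mem 2⁻¹ (Submodule.subset_span h1)
    have h6 := W.smul_mem 2⁻¹ (Submodule.subset_span h2)
    exact ⟨h3 ▸ W.add_mem h5 h6, h4 ▸ W.sub_mem h5 h6⟩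
  have hdiag : ∀ u v : ℍ, ‖u‖ = 1 → ‖v‖ = 1 → !![u, 0; 0, 0] ∈ W ∧ !![0, 0; 0, v] ∈ W := by
    intro u v hu hv
    refine key _ _ ?_ ?_
    · convert diagonal_mem_Sp hu hv using 1
      ext i j : 1
      fin_cases i <;> fin_cases j <;> simp
    · convert diagonal_mem_Sp (v := -v) hu (by simpa) using 1
      ext i j : 1
      fin_cases i <;> fin_cases j <;> simp
  have hanti : ∀ u v : ℍ, ‖u‖ = 1 → ‖v‖ = 1 → !![0, u; 0, 0] ∈ W ∧ !![0, 0; v, 0] ∈ W := by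
    intro u v hu hv
    refine key _ _ ?_ ?_
    · convert antidiagonal_mem_Sp hu hv using 1
      ext i j : 1
      fin_cases i <;> fin_cases j <;> simp
    · convert antidiagonal_mem_Sp (v := -v) hu (by simpa) using 1
      ext i j : 1
      fin_cases i <;> fin_cases j <;> simp
  obtain ⟨a, ha, hXa⟩ := exists_eq_norm_smul_unit (X 0 0)
  obtain ⟨b, hb, hXb⟩ := exists_eq_norm_smul_unit (X 0 1)
  obtain ⟨c, hc, hXc⟩ := exists_eq_norm_smul_unit (X 1 0)
  obtain ⟨d, hd, hXd⟩ := exists_eq_norm_smul_unit (X 1 1)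
  have hX : X = ‖X 0 0‖ • !![a, 0; 0, 0] + ‖X 0 1‖ • !![0, b; 0, 0] +
      ‖X 1 0‖ • !![0, 0; c, 0] + ‖X 1 1‖ • !![0, 0; 0, d] := by
    ext i j : 1
    fin_cases i <;> fin_cases j
    · simpa using hXa
    · simpa using hXb
    · simpa using hXc
    · simpa using hXd
  rw [hX]
  exact W.add_mem (W.add_mem (W.add_mem (W.smul_mem _ (hdiag a d ha hd).1)
    (W.smul_mem _ (hanti b c hb hc).1)) (W.smul_mem _ (hanti b c hb hc).2))
    (W.smul_mem _ (hdiag a d ha hd).2)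

/-! ### The spin representation in dimension five -/

/-- Quaternionic coordinates on `ℂ⁴`. -/
noncomputable def quaternionCoords : (Fin 2 → ℍ) ≃ₗ[ℝ] (Fin 4 → ℂ) where
  -- A quaternion is written `a + j b` with `a`, `b` complex, so that right multiplication by `z ∈
  -- ℂ` is `(a, b) ↦ (a z, b z)`. As `j i = -k`, the imaginary part of `b` is minus the
  -- `k`-coordinate.
  toFun h := ![⟨(h 0).re, (h 0).imI⟩, ⟨(h 1).re, (h 1).imI⟩, ⟨(h 1).imJ, -(h 1).imK⟩,
    ⟨(h 0).imJ, -(h 0).imK⟩]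
  invFun c := ![⟨(c 0).re, (c 0).im, (c 3).re, -(c 3).im⟩,
    ⟨(c 1).re, (c 1).im, (c 2).re, -(c 2).im⟩]
  map_add' h k := by
    funext i
    fin_cases i <;> apply Complex.ext <;> simp [add_comm]
  map_smul' t h := by
    funext i
    fin_cases i <;> apply Complex.ext <;> simp
  left_inv h := by
    funext i
    fin_cases i <;> ext <;> simp
  right_inv c := by
    funext i
    fin_cases i <;> apply Complex.ext <;> simp

/-- The spinors on `ℂ²` as quaternionic vectors. -/
noncomputable def quaternionSpinor : (Fin 2 → ℍ) ≃ₗ[ℝ] Spinors 2 :=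
  quaternionCoords ≪≫ₗ (LinearEquiv.ofBijective spinor₂ spinor₂_bijective).restrictScalars ℝ

theorem quaternionSpinor_apply (h : Fin 2 → ℍ) :
    quaternionSpinor h = spinor₂ (quaternionCoords h) := rfl

theorem quaternionCoords_smul (z : ℂ) (h : Fin 2 → ℍ) :
    quaternionCoords (fun j => h j * (z : ℍ)) = z • quaternionCoords h := by
  funext i
  fin_cases i <;> apply Complex.ext <;> simp [quaternionCoords] <;> ring

theorem quaternionSpinor_smul (z : ℂ) (h : Fin 2 → ℍ) :
    quaternionSpinor (fun j => h j * (z : ℍ)) = z • quaternionSpinor h := by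
  rw [quaternionSpinor_apply, quaternionCoords_smul, map_smul, quaternionSpinor_apply]

theorem parity_gen {n : ℕ} (r : Fin n) : parity n (gen r) = -gen r :=
  involute_ι (Q := (0 : QuadraticForm ℂ (Fin n → ℂ))) _

theorem parity_mul {n : ℕ} (x y : Spinors n) : parity n (x * y) = parity n x * parity n y :=
  map_mul (involute (Q := (0 : QuadraticForm ℂ (Fin n → ℂ)))) x y

theorem parity_one (n : ℕ) : parity n 1 = 1 :=
  map_one (involute (Q := (0 : QuadraticForm ℂ (Fin n → ℂ))))

theorem parity_spinor₂ (c : Fin 4 → ℂ) :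
    parity 2 (spinor₂ c) = spinor₂ ![c 0, -c 1, -c 2, c 3] := by
  simp [spinor₂_apply, parity_gen, parity_mul, parity_one]

/-- The sign and index choices in `vecQuaternion` and `quaternionCoords` are made for this identity.
A single vector is not right `ℍ`-linear, because of the factor `i` on the right; products of two
vectors are. -/
theorem oddVectorAction_quaternionSpinor (v : Fin 5 → ℝ) (h : Fin 2 → ℍ) :
    oddVectorAction 2 v (quaternionSpinor h) =
      quaternionSpinor fun j => (hermMatrix v).mulVec h j * ((Complex.I : ℂ) : ℍ) := by
  rw [oddVectorAction_apply, quaternionSpinor_apply, quaternionSpinor_apply, parity_spinor₂,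
    vectorAction_apply, ι_mul_spinor₂]
  have h1 := annihilation_spinor₂ (complexify 2 fun j => v j.castSucc) (quaternionCoords h)
  rw [annihilation] at h1
  rw [h1, ← map_smul, ← map_sub, ← map_add]
  congr 1
  funext i
  fin_cases i <;> apply Complex.ext <;>
    simp [quaternionCoords, complexify, hermMatrix_apply, mulVec, dotProduct,
      Fin.sum_univ_two] <;> ring

theorem half_quaternionSpinor (g : Spin 5) (h : Fin 2 → ℍ) :
    spinRep 2 g (quaternionSpinor h) =
      quaternionSpinor ((quaternionicPair.half g).mulVec h) := by
  -- Right multiplication by `-i` gives a second parametrization of the same spinors. It plays the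
  -- role of the second module, so that the factor `i` is absorbed and vectors act by `-hermMatrix`
  -- one way and `hermMatrix` the other.
  let R : (Fin 2 → ℍ) →ₗ[ℝ] (Fin 2 → ℍ) :=
    { toFun := fun h j => -(h j * ((Complex.I : ℂ) : ℍ))
      map_add' := fun h k => by
        funext j
        simp [add_mul, add_comm]
      map_smul' := fun t h => by
        funext j
        simp }
  have hI : ∀ h : Fin 2 → ℍ, quaternionSpinor (R h) = -(Complex.I • quaternionSpinor h) := by
    intro h
    rw [← quaternionSpinor_smul, ← map_neg]
    rfl
  have hα : ∀ v : Fin 5 → ℝ, oddCliffordAction 2 (ι (negForm 5) v) = oddVectorAction 2 v :=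
    fun v => lift_ι_apply _ _ _
  refine quaternionicPair.action_eq (oddCliffordAction 2) quaternionSpinor.toLinearMap
    (quaternionSpinor.toLinearMap ∘ₗ R) ?_ ?_ (spinGroup.mem_even g.2) h
  · intro v c
    rw [hα]
    refine (oddVectorAction_quaternionSpinor v c).trans ?_
    change _ = quaternionSpinor (R ((-hermMatrix v).mulVec c))
    congr 1
    funext j
    simp only [R, LinearMap.coe_mk, AddHom.coe_mk, neg_mulVec, Pi.neg_apply, neg_mul, neg_neg]
  · intro v c
    rw [hα]
    change oddVectorAction 2 v (quaternionSpinor (R c)) =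
      quaternionSpinor ((hermMatrix v).mulVec c)
    rw [hI, map_neg, map_smul, oddVectorAction_quaternionSpinor, quaternionSpinor_smul, smul_smul,
      Complex.I_mul_I, neg_smul, one_smul, neg_neg]

end SpinGroups

namespace SpinGroups

open CliffordAlgebra Matrix

/-! ### The half-spin representation in dimension six -/

/-- The matrix by which a vector of `ℂ³` maps even spinors to odd spinors. -/
noncomputable def weylMatrix (w : Fin 3 → ℂ) : Matrix (Fin 4) (Fin 4) ℂ :=
  !![w 0, star (w 1), star (w 2), 0;
    w 1, -star (w 0), 0, star (w 2);
    w 2, 0, -star (w 0), -star (w 1);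
    0, w 2, -w 1, w 0]

theorem weylMatrix_add (w z : Fin 3 → ℂ) : weylMatrix (w + z) = weylMatrix w + weylMatrix z := by
  ext i j : 1
  fin_cases i <;> fin_cases j <;> simp [weylMatrix, add_comm]

theorem weylMatrix_smul (t : ℝ) (w : Fin 3 → ℂ) : weylMatrix (t • w) = t • weylMatrix w := by
  ext i j : 1
  fin_cases i <;> fin_cases j <;> simp [weylMatrix]

theorem weylMatrix_mul_conjTranspose (w : Fin 3 → ℂ) :
    weylMatrix w * (weylMatrix w)ᴴ = diagonal fun _ => ∑ r, star (w r) * w r := by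
  ext i j : 1
  fin_cases i <;> fin_cases j <;>
    simp [weylMatrix, Matrix.mul_apply, Fin.sum_univ_succ] <;> ring

theorem conjTranspose_mul_weylMatrix (w : Fin 3 → ℂ) :
    (weylMatrix w)ᴴ * weylMatrix w = diagonal fun _ => ∑ r, star (w r) * w r := by
  ext i j : 1
  fin_cases i <;> fin_cases j <;>
    simp [weylMatrix, Matrix.mul_apply, Fin.sum_univ_succ] <;> ring

/-- Needed for its positivity when `w ≠ 0`: unitarity alone leaves the determinant free up to a
phase. -/
theorem det_weylMatrix (w : Fin 3 → ℂ) :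
    (weylMatrix w).det = (∑ r, star (w r) * w r) ^ 2 := by
  simp [weylMatrix, det_succ_row_zero, Fin.sum_univ_succ, Fin.succAbove]
  ring

theorem sum_star_complexify_mul (v : Fin 6 → ℝ) :
    ∑ r, star (complexify 3 v r) * complexify 3 v r = -((negForm 6 v : ℝ) : ℂ) := by
  rw [← hermDual_complexify_self 3 v, hermDual_apply]
  rfl

/-- The action of vectors of `ℝ⁶` on spinors in matrix form. -/
noncomputable def weylPair : CliffordPair 6 4 ℂ where
  A :=
    { toFun := fun v => -(weylMatrix (complexify 3 v))ᴴ
      map_add' := fun v w => by rw [map_add, weylMatrix_add, conjTranspose_add, neg_add]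
      map_smul' := fun t v => by
        rw [map_smul, weylMatrix_smul, conjTranspose_smul, star_trivial, smul_neg]
        rfl }
  B :=
    { toFun := fun v => weylMatrix (complexify 3 v)
      map_add' := fun v w => by rw [map_add, weylMatrix_add]
      map_smul' := fun t v => by
        rw [map_smul, weylMatrix_smul]
        rfl }
  A_mul_B v := by
    simp only [LinearMap.coe_mk, AddHom.coe_mk]
    rw [neg_mul, conjTranspose_mul_weylMatrix, sum_star_complexify_mul, algebraMap_eq_diagonal,
      diagonal_neg]
    simp
  B_mul_A v := by
    simp only [LinearMap.coe_mk, AddHom.coe_mk]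
    rw [mul_neg, weylMatrix_mul_conjTranspose, sum_star_complexify_mul, algebraMap_eq_diagonal,
      diagonal_neg]
    simp
  conjTranspose_A v := by simp
  star_algebraMap r := Complex.conj_ofReal r

theorem weylPair_A (v : Fin 6 → ℝ) : weylPair.A v = -(weylMatrix (complexify 3 v))ᴴ := rfl

theorem weylPair_B (v : Fin 6 → ℝ) : weylPair.B v = weylMatrix (complexify 3 v) := rfl

theorem finrank_complexMatrix : Module.finrank ℝ (Matrix (Fin 4) (Fin 4) ℂ) = 2 ^ 5 := by
  rw [Module.finrank_matrix, Complex.finrank_real_complex]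
  simp

theorem vectorAction_evenSpinor₃ (v : Fin 6 → ℝ) (c : Fin 4 → ℂ) :
    vectorAction 3 v (evenSpinor₃ c) = oddSpinor₃ ((weylMatrix (complexify 3 v)).mulVec c) := by
  have h1 := annihilation_evenSpinor₃ (complexify 3 v) c
  rw [annihilation] at h1
  rw [vectorAction_apply, ι_mul_evenSpinor₃, h1, ← map_sub]
  congr 1
  funext i
  fin_cases i <;> simp [weylMatrix, mulVec, dotProduct, Fin.sum_univ_succ] <;> ring

theorem vectorAction_oddSpinor₃ (v : Fin 6 → ℝ) (c : Fin 4 → ℂ) :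
    vectorAction 3 v (oddSpinor₃ c) =
      evenSpinor₃ ((-(weylMatrix (complexify 3 v))ᴴ).mulVec c) := by
  have h1 := annihilation_oddSpinor₃ (complexify 3 v) c
  rw [annihilation] at h1
  rw [vectorAction_apply, ι_mul_oddSpinor₃, h1, ← map_sub]
  congr 1
  funext i
  fin_cases i <;> simp [weylMatrix, mulVec, dotProduct, Fin.sum_univ_succ] <;> ring

theorem halfSpinRepPlus_evenSpinorEquiv (g : Spin 6) (c : Fin 4 → ℂ) :
    halfSpinRepPlus 3 g (evenSpinorEquiv c) = evenSpinorEquiv ((weylPair.half g).mulVec c) := by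
  have hα : ∀ v : Fin 6 → ℝ, cliffordAction 3 (ι (negForm 6) v) = vectorAction 3 v :=
    fun v => lift_ι_apply _ _ _
  refine Subtype.ext ?_
  refine weylPair.action_eq (cliffordAction 3) (evenSpinor₃.restrictScalars ℝ)
    (oddSpinor₃.restrictScalars ℝ) ?_ ?_ (spinGroup.mem_even g.2) c
  · intro v c
    rw [hα]
    exact vectorAction_evenSpinor₃ v c
  · intro v c
    rw [hα]
    exact vectorAction_oddSpinor₃ v c

/-! ### Determinants -/

/-- Elements of the Lipschitz group act by block matrices with equal positive determinants. -/
theorem exists_rep_eq_of_mem_lipschitzGroup {x : (CliffordAlgebra (negForm 6))ˣ}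
    (hx : x ∈ lipschitzGroup (negForm 6)) :
    ∃ (P Q : Matrix (Fin 4) (Fin 4) ℂ) (r : ℝ), 0 < r ∧ P.det = r ∧ Q.det = r ∧
      (weylPair.rep x = fromBlocks P 0 0 Q ∨ weylPair.rep x = fromBlocks 0 P Q 0) := by
  unfold lipschitzGroup at hx
  induction hx using Subgroup.closure_induction with
  | mem x hx =>
    obtain ⟨v, hv⟩ := hx
    -- A generator is a unit, so its square cannot vanish; this makes the determinant `(negForm 6
    -- v)²` strictly positive.
    have h0 : negForm 6 v ≠ 0 := by
      intro h
      have h1 := ι_sq_scalar (negForm 6) v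
      rw [h, map_zero, hv, ← Units.val_mul] at h1
      exact (x * x).ne_zero h1
    refine ⟨weylPair.A v, weylPair.B v, negForm 6 v ^ 2, by positivity, ?_, ?_, Or.inr ?_⟩
    · rw [weylPair_A, det_neg, det_conjTranspose, det_weylMatrix, sum_star_complexify_mul]
      norm_num
    · rw [weylPair_B, det_weylMatrix, sum_star_complexify_mul]
      simp
    · rw [← hv, weylPair.rep_ι]
  | one => exact ⟨1, 1, 1, one_pos, by simp, by simp, Or.inl (by simp)⟩
  | mul x y _ _ hx hy =>
    obtain ⟨P, Q, r, hr, hP, hQ, h⟩ := hx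
    obtain ⟨P', Q', r', hr', hP', hQ', h'⟩ := hy
    rw [Units.val_mul, map_mul]
    rcases h with h | h <;> rcases h' with h' | h' <;> rw [h, h', fromBlocks_multiply]
    · exact ⟨P * P', Q * Q', r * r', mul_pos hr hr', by simp [hP, hP'], by simp [hQ, hQ'],
        Or.inl (by simp)⟩
    · exact ⟨P * P', Q * Q', r * r', mul_pos hr hr', by simp [hP, hP'], by simp [hQ, hQ'],
        Or.inr (by simp)⟩
    · exact ⟨P * Q', Q * P', r * r', mul_pos hr hr', by simp [hP, hQ'], by simp [hQ, hP'],
        Or.inr (by simp)⟩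
    · exact ⟨P * Q', Q * P', r * r', mul_pos hr hr', by simp [hP, hQ'], by simp [hQ, hP'],
        Or.inl (by simp)⟩
  | inv x _ hx =>
    obtain ⟨P, Q, r, hr, hP, hQ, h⟩ := hx
    have hr0 : (r : ℂ) ≠ 0 := by exact_mod_cast hr.ne'
    have hPu : IsUnit P.det := by rw [hP]; exact hr0.isUnit
    have hQu : IsUnit Q.det := by rw [hQ]; exact hr0.isUnit
    have hxx : weylPair.rep (x⁻¹ : (CliffordAlgebra (negForm 6))ˣ) * weylPair.rep x = 1 := by
      rw [← map_mul, Units.inv_mul, map_one]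
    rcases h with h | h <;> rw [h] at hxx
    · refine ⟨P⁻¹, Q⁻¹, r⁻¹, inv_pos.2 hr, by simp [det_nonsing_inv, hP],
        by simp [det_nonsing_inv, hQ], Or.inl (left_inv_eq_right_inv hxx ?_)⟩
      simp [fromBlocks_multiply, mul_nonsing_inv _ hPu, mul_nonsing_inv _ hQu]
    · refine ⟨Q⁻¹, P⁻¹, r⁻¹, inv_pos.2 hr, by simp [det_nonsing_inv, hQ],
        by simp [det_nonsing_inv, hP], Or.inr (left_inv_eq_right_inv hxx ?_)⟩
      simp [fromBlocks_multiply, mul_nonsing_inv _ hPu, mul_nonsing_inv _ hQu]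

/-- The determinant is a positive real by the Lipschitz description and has modulus 1 by unitarity,
hence equals 1. -/
theorem spinHom_weylPair_mem_SU (g : Spin 6) : weylPair.spinHom g ∈ SU 4 := by
  have hu := weylPair.spinHom_mem_unitary g
  refine mem_specialUnitaryGroup_iff.2 ⟨hu, ?_⟩
  obtain ⟨x, hx, hxg⟩ := pinGroup.mem_lipschitzGroup (spinGroup.mem_pin g.2)
  obtain ⟨P, Q, r, hr, hP, -, h⟩ := exists_rep_eq_of_mem_lipschitzGroup hx
  have hg : weylPair.spinHom g = (weylPair.rep x).toBlocks₁₁ := by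
    change (weylPair.rep g).toBlocks₁₁ = _
    rw [← hxg]
    rfl
  rcases h with h | h <;> rw [h, toBlocks_fromBlocks₁₁] at hg <;> rw [hg] at hu ⊢
  · have h1 := congrArg det (Unitary.mem_iff.1 hu).1
    rw [det_mul, star_eq_conjTranspose, det_conjTranspose, hP, det_one, Complex.star_def,
      Complex.conj_ofReal] at h1
    have h2 : r * r = 1 := by exact_mod_cast h1
    have h3 : r = 1 := by nlinarith
    rw [hP, h3, Complex.ofReal_one]
  -- In the off-diagonal case the first block would be zero, which is not unitary.
  · simpa using (Unitary.mem_iff.1 hu).1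

end SpinGroups

namespace SpinGroups

open CliffordAlgebra Matrix

/-! ### Generation of `SU(4)` -/

/-- The submonoid of matrices coming from `Spin(6)`. -/
noncomputable abbrev spinImage₆ : Submonoid (Matrix (Fin 4) (Fin 4) ℂ) :=
  MonoidHom.mrange weylPair.spinHom

/-- The matrix in `SU(2)` with first row `(x, y)`, acting on two consecutive coordinates. -/
noncomputable def givens (k : Fin 3) (x y : ℂ) : Matrix (Fin 4) (Fin 4) ℂ :=
  match k with
  | 0 => !![x, y, 0, 0; -star y, star x, 0, 0; 0, 0, 1, 0; 0, 0, 0, 1]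
  | 1 => !![1, 0, 0, 0; 0, x, y, 0; 0, -star y, star x, 0; 0, 0, 0, 1]
  | 2 => !![1, 0, 0, 0; 0, 1, 0, 0; 0, 0, x, y; 0, 0, -star y, star x]

theorem givens_mul (k : Fin 3) (x y x' y' : ℂ) :
    givens k x y * givens k x' y' =
      givens k (x * x' - y * star y') (x * y' + y * star x') := by
  ext i j : 1
  fin_cases k <;> fin_cases i <;> fin_cases j <;>
    simp [givens, Matrix.mul_apply, Fin.sum_univ_succ] <;> ring

theorem rotor_eq (D : CliffordPair 6 4 ℂ) {a b : Fin 6} {M : Matrix (Fin 4) (Fin 4) ℂ}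
    (hab : a ≠ b) (hM : D.A (stdVec a) * D.B (stdVec b) = M) {c s : ℝ} (h : c ^ 2 + s ^ 2 = 1) :
    diagonal (fun _ => (c : ℂ)) + (s : ℂ) • M ∈ MonoidHom.mrange D.spinHom := by
  have := D.rotor_mem_mrange hab h
  rwa [hM, algebraMap_eq_diagonal] at this

/-- These seven products are the bivectors used to generate `SU(4)`. Those used together commute and
square to `-1`; they agree up to sign on one pair of coordinates and have the other relative sign on
the complementary pair. -/
theorem weylPair_mul₀₁ : weylPair.A (stdVec 0) * weylPair.B (stdVec 1) =
    !![Complex.I, 0, 0, 0; 0, -Complex.I, 0, 0; 0, 0, -Complex.I, 0; 0, 0, 0, Complex.I] := by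
  ext i j : 1
  fin_cases i <;> fin_cases j <;>
    simp [weylPair_A, weylPair_B, weylMatrix, complexify, Matrix.mul_apply, Fin.sum_univ_succ,
      Fin.ext_iff]

theorem weylPair_mul₂₃ : weylPair.A (stdVec 2) * weylPair.B (stdVec 3) =
    !![Complex.I, 0, 0, 0; 0, -Complex.I, 0, 0; 0, 0, Complex.I, 0; 0, 0, 0, -Complex.I] := by
  ext i j : 1
  fin_cases i <;> fin_cases j <;>
    simp [weylPair_A, weylPair_B, weylMatrix, complexify, Matrix.mul_apply, Fin.sum_univ_succ,
      Fin.ext_iff]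

theorem weylPair_mul₄₅ : weylPair.A (stdVec 4) * weylPair.B (stdVec 5) =
    !![Complex.I, 0, 0, 0; 0, Complex.I, 0, 0; 0, 0, -Complex.I, 0; 0, 0, 0, -Complex.I] := by
  ext i j : 1
  fin_cases i <;> fin_cases j <;>
    simp [weylPair_A, weylPair_B, weylMatrix, complexify, Matrix.mul_apply, Fin.sum_univ_succ,
      Fin.ext_iff]

theorem weylPair_mul₀₂ : weylPair.A (stdVec 0) * weylPair.B (stdVec 2) =
    !![0, -1, 0, 0; 1, 0, 0, 0; 0, 0, 0, -1; 0, 0, 1, 0] := by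
  ext i j : 1
  fin_cases i <;> fin_cases j <;>
    simp [weylPair_A, weylPair_B, weylMatrix, complexify, Matrix.mul_apply, Fin.sum_univ_succ,
      Fin.ext_iff]

theorem weylPair_mul₁₃ : weylPair.A (stdVec 1) * weylPair.B (stdVec 3) =
    !![0, 1, 0, 0; -1, 0, 0, 0; 0, 0, 0, -1; 0, 0, 1, 0] := by
  ext i j : 1
  fin_cases i <;> fin_cases j <;>
    simp [weylPair_A, weylPair_B, weylMatrix, complexify, Matrix.mul_apply, Fin.sum_univ_succ,
      Fin.ext_iff]

theorem weylPair_mul₂₄ : weylPair.A (stdVec 2) * weylPair.B (stdVec 4) =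
    !![0, 0, 0, -1; 0, 0, -1, 0; 0, 1, 0, 0; 1, 0, 0, 0] := by
  ext i j : 1
  fin_cases i <;> fin_cases j <;>
    simp [weylPair_A, weylPair_B, weylMatrix, complexify, Matrix.mul_apply, Fin.sum_univ_succ,
      Fin.ext_iff]

theorem weylPair_mul₃₅ : weylPair.A (stdVec 3) * weylPair.B (stdVec 5) =
    !![0, 0, 0, 1; 0, 0, -1, 0; 0, 1, 0, 0; -1, 0, 0, 0] := by
  ext i j : 1
  fin_cases i <;> fin_cases j <;>
    simp [weylPair_A, weylPair_B, weylMatrix, complexify, Matrix.mul_apply, Fin.sum_univ_succ,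
      Fin.ext_iff]

/-- Two diagonal rotors, with signs chosen so that their angles add on coordinates `k`, `k + 1` and
cancel on the other two. -/
theorem givens_phase_mem (k : Fin 3) {z : ℂ} (hz : ‖z‖ = 1) : givens k z 0 ∈ spinImage₆ := by
  obtain ⟨c, s, h, rfl⟩ := exists_unit_sq_eq hz
  have hC := ofReal_sq_add_sq h
  have h' : c ^ 2 + (-s) ^ 2 = 1 := by rwa [neg_sq]
  have hI := Complex.I_sq
  fin_cases k
  · convert mul_mem (rotor_eq weylPair (by decide) weylPair_mul₀₁ h)
      (rotor_eq weylPair (by decide) weylPair_mul₂₃ h) using 1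
    ext i j : 1
    fin_cases i <;> fin_cases j <;>
      simp [givens, Matrix.mul_apply, Fin.sum_univ_succ] <;>
      first | ring1 | linear_combination -hC + s ^ 2 * hI
  · convert mul_mem (rotor_eq weylPair (by decide) weylPair_mul₄₅ h)
      (rotor_eq weylPair (by decide) weylPair_mul₂₃ h') using 1
    ext i j : 1
    fin_cases i <;> fin_cases j <;>
      simp [givens, Matrix.mul_apply, Fin.sum_univ_succ] <;>
      first | ring1 | linear_combination -hC + s ^ 2 * hI
  · convert mul_mem (rotor_eq weylPair (by decide) weylPair_mul₂₃ h)
      (rotor_eq weylPair (by decide) weylPair_mul₀₁ h') using 1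
    ext i j : 1
    fin_cases i <;> fin_cases j <;>
      simp [givens, Matrix.mul_apply, Fin.sum_univ_succ] <;>
      first | ring1 | linear_combination -hC + s ^ 2 * hI

theorem givens_rotation_mem (k : Fin 3) {c s : ℝ} (h : c ^ 2 + s ^ 2 = 1) :
    givens k c s ∈ spinImage₆ := by
  -- The half angle is taken of `c - s i`, because on the active pair the signed bivectors act by
  -- `!![0, -1; 1, 0]`, the negative of the rotation direction in `givens`.
  have hz : ‖(⟨c, -s⟩ : ℂ)‖ = 1 := by
    rw [Complex.norm_def, Complex.normSq_mk, ← sq, ← sq, neg_sq, h, Real.sqrt_one]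
  obtain ⟨d, t, hd, hdt⟩ := exists_unit_sq_eq hz
  have hd' : d ^ 2 + (-t) ^ 2 = 1 := by rwa [neg_sq]
  have hc : (c : ℂ) = d * d - t * t := by
    exact_mod_cast (show c = d * d - t * t by simpa [sq] using congrArg Complex.re hdt)
  have hs : (s : ℂ) = -(d * t + t * d) := by
    have h1 : s = -(d * t + t * d) := by
      rw [← show -s = d * t + t * d by simpa [sq] using congrArg Complex.im hdt, neg_neg]
    exact_mod_cast h1
  have hC := ofReal_sq_add_sq hd
  fin_cases k
  · convert mul_mem (rotor_eq weylPair (by decide) weylPair_mul₀₂ hd)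
      (rotor_eq weylPair (by decide) weylPair_mul₁₃ hd') using 1
    ext i j : 1
    fin_cases i <;> fin_cases j <;>
      simp [givens, Matrix.mul_apply, Fin.sum_univ_succ, hc, hs] <;>
      first | ring1 | linear_combination -hC
  · convert mul_mem (rotor_eq weylPair (by decide) weylPair_mul₂₄ hd)
      (rotor_eq weylPair (by decide) weylPair_mul₃₅ hd) using 1
    ext i j : 1
    fin_cases i <;> fin_cases j <;>
      simp [givens, Matrix.mul_apply, Fin.sum_univ_succ, hc, hs] <;>
      first | ring1 | linear_combination -hC
  · convert mul_mem (rotor_eq weylPair (by decide) weylPair_mul₀₂ hd)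
      (rotor_eq weylPair (by decide) weylPair_mul₁₃ hd) using 1
    ext i j : 1
    fin_cases i <;> fin_cases j <;>
      simp [givens, Matrix.mul_apply, Fin.sum_univ_succ, hc, hs] <;>
      first | ring1 | linear_combination -hC

/-- Phase, real rotation, phase: the product of `givens k p 0`, `givens k ‖x‖ ‖y‖` and `givens k q
0` has first row `(‖x‖ p q, ‖y‖ p q̄)`. -/
theorem givens_mem (k : Fin 3) {x y : ℂ} (h : ‖x‖ ^ 2 + ‖y‖ ^ 2 = 1) :
    givens k x y ∈ spinImage₆ := by
  obtain ⟨p, q, hp, hq, hx, hy⟩ := exists_phase_rotation_phase x y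
  have := mul_mem (mul_mem (givens_phase_mem k hp) (givens_rotation_mem k h))
    (givens_phase_mem k hq)
  rw [givens_mul, givens_mul] at this
  convert this using 1
  congr 1
  · simp only [star_zero, mul_zero, zero_mul, sub_zero]
    linear_combination hx
  · simp only [zero_mul, mul_zero, add_zero, zero_add, Complex.star_def] at hy ⊢
    linear_combination hy

end SpinGroups

/-! ### Givens elimination in `SU(4)` -/

namespace SpinGroups

open CliffordAlgebra Matrix

/-- Take `(x, y) = (ā, b̄) / r` with `r` the length of `(a, b)`, and the identity if both vanish. -/
theorem exists_givens_eq (a b : ℂ) : ∃ x y : ℂ, ‖x‖ ^ 2 + ‖y‖ ^ 2 = 1 ∧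
    (∃ r : ℝ, 0 ≤ r ∧ x * a + y * b = r) ∧ -star y * a + star x * b = 0 := by
  by_cases h : a = 0 ∧ b = 0
  · obtain ⟨rfl, rfl⟩ := h
    exact ⟨1, 0, by simp, ⟨0, le_rfl, by simp⟩, by simp⟩
  have hpos : 0 < ‖a‖ ^ 2 + ‖b‖ ^ 2 := by
    rcases not_and_or.1 h with h | h
    · have := norm_pos_iff.2 h
      positivity
    · have := norm_pos_iff.2 h
      positivity
  set r := √(‖a‖ ^ 2 + ‖b‖ ^ 2) with hr
  have hr0 : 0 < r := Real.sqrt_pos.2 hpos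
  have hr2 : r ^ 2 = ‖a‖ ^ 2 + ‖b‖ ^ 2 := Real.sq_sqrt hpos.le
  have hrC : (r : ℂ) ≠ 0 := by exact_mod_cast hr0.ne'
  refine ⟨star a / r, star b / r, ?_, ⟨r, hr0.le, ?_⟩, ?_⟩
  · rw [norm_div, norm_div, norm_star, norm_star, Complex.norm_real, Real.norm_of_nonneg hr0.le,
      div_pow, div_pow, ← add_div, hr2, div_self hpos.ne']
  · have h2 : (r : ℂ) ^ 2 = star a * a + star b * b := by
      rw [Complex.star_def, Complex.conj_mul', Complex.conj_mul']
      exact_mod_cast hr2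
    field_simp
    rw [h2]
  · rw [star_div₀, star_div₀, star_star, star_star, Complex.star_def, Complex.conj_ofReal]
    ring

theorem givens_mul_apply (k : Fin 3) (x y : ℂ) (U : Matrix (Fin 4) (Fin 4) ℂ) (l : Fin 4) :
    (givens k x y * U) k.castSucc l = x * U k.castSucc l + y * U k.succ l ∧
    (givens k x y * U) k.succ l = -star y * U k.castSucc l + star x * U k.succ l ∧
    ∀ i, i ≠ k.castSucc → i ≠ k.succ → (givens k x y * U) i l = U i l := by
  fin_cases k <;> refine ⟨?_, ?_, fun i h1 h2 => ?_⟩ <;>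
    first
    | (fin_cases i <;>
        first
        | exact absurd rfl h1
        | exact absurd rfl h2
        | simp [givens, Matrix.mul_apply, Fin.sum_univ_succ])
    | simp [givens, Matrix.mul_apply, Fin.sum_univ_succ]

theorem mrange_weylPair_le_SU {X : Matrix (Fin 4) (Fin 4) ℂ} (hX : X ∈ spinImage₆) : X ∈ SU 4 := by
  obtain ⟨g, rfl⟩ := hX
  exact spinHom_weylPair_mem_SU g

/-- Multiplying by an element of `spinImage₆`, one can annihilate an entry of a column against
the entry above it. -/
theorem exists_eliminate {U : Matrix (Fin 4) (Fin 4) ℂ} (hU : U ∈ SU 4) (k : Fin 3) (j : Fin 4) :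
    ∃ V ∈ SU 4, (V ∈ spinImage₆ → U ∈ spinImage₆) ∧
      (∃ r : ℝ, 0 ≤ r ∧ V k.castSucc j = r) ∧ V k.succ j = 0 ∧
      (∀ l, U k.castSucc l = 0 → U k.succ l = 0 → V k.castSucc l = 0 ∧ V k.succ l = 0) ∧
      ∀ i l, i ≠ k.castSucc → i ≠ k.succ → V i l = U i l := by
  obtain ⟨x, y, hxy, ⟨r, hr, h1⟩, h2⟩ := exists_givens_eq (U k.castSucc j) (U k.succ j)
  have hX := givens_mem k hxy
  refine ⟨givens k x y * U, mul_mem (mrange_weylPair_le_SU hX) hU,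
    mem_of_mul_mem (weylPair.star_mem_mrange hX) (mrange_weylPair_le_SU hX).1,
    ⟨r, hr, ?_⟩, ?_, fun l h3 h4 => ⟨?_, ?_⟩, fun i l => (givens_mul_apply k x y U l).2.2 i⟩
  · rw [(givens_mul_apply k x y U j).1, h1]
  · rw [(givens_mul_apply k x y U j).2.1, h2]
  · rw [(givens_mul_apply k x y U l).1, h3, h4, mul_zero, mul_zero, add_zero]
  · rw [(givens_mul_apply k x y U l).2.1, h3, h4, mul_zero, mul_zero, add_zero]

theorem eq_one_of_star_mul_self {z : ℂ} (hz : ∃ r : ℝ, 0 ≤ r ∧ z = r) (h : star z * z = 1) :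
    z = 1 := by
  obtain ⟨r, hr, rfl⟩ := hz
  rw [Complex.star_def, Complex.conj_ofReal] at h
  have h1 : r * r = 1 := by exact_mod_cast h
  have h2 : r = 1 := by nlinarith
  rw [h2, Complex.ofReal_one]

/-- Orthonormality of the columns, used row by row, forces an upper triangular unitary matrix to be
diagonal. The first three entries are nonnegative of modulus 1, and the determinant settles the
last. -/
theorem eq_one_of_upperTriangular {V : Matrix (Fin 4) (Fin 4) ℂ} (hV : V ∈ SU 4)
    (h10 : V 1 0 = 0) (h20 : V 2 0 = 0) (h30 : V 3 0 = 0) (h21 : V 2 1 = 0) (h31 : V 3 1 = 0)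
    (h32 : V 3 2 = 0) (h00 : ∃ r : ℝ, 0 ≤ r ∧ V 0 0 = r) (h11 : ∃ r : ℝ, 0 ≤ r ∧ V 1 1 = r)
    (h22 : ∃ r : ℝ, 0 ≤ r ∧ V 2 2 = r) : V = 1 := by
  have e : ∀ i j, star (V 0 i) * V 0 j + (star (V 1 i) * V 1 j + (star (V 2 i) * V 2 j +
      star (V 3 i) * V 3 j)) = (1 : Matrix (Fin 4) (Fin 4) ℂ) i j := fun i j => by
    rw [← (Unitary.mem_iff.1 hV.1).1, star_eq_conjTranspose, Matrix.mul_apply, Fin.sum_univ_four]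
    simp only [conjTranspose_apply, add_assoc]
  have a00 : V 0 0 = 1 := eq_one_of_star_mul_self h00 (by simpa [h10, h20, h30] using e 0 0)
  have a01 : V 0 1 = 0 := by simpa [a00, h10, h20, h30] using e 0 1
  have a02 : V 0 2 = 0 := by simpa [a00, h10, h20, h30] using e 0 2
  have a03 : V 0 3 = 0 := by simpa [a00, h10, h20, h30] using e 0 3
  have a11 : V 1 1 = 1 := eq_one_of_star_mul_self h11 (by simpa [a01, h21, h31] using e 1 1)
  have a12 : V 1 2 = 0 := by simpa [a01, a11, h21, h31] using e 1 2
  have a13 : V 1 3 = 0 := by simpa [a01, a11, h21, h31] using e 1 3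
  have a22 : V 2 2 = 1 := eq_one_of_star_mul_self h22 (by simpa [a02, a12, h32] using e 2 2)
  have a23 : V 2 3 = 0 := by simpa [a02, a12, a22, h32] using e 2 3
  have hd : V = diagonal ![1, 1, 1, V 3 3] := by
    ext i j : 1
    fin_cases i <;> fin_cases j <;> simp [*]
  have hdet := (mem_specialUnitaryGroup_iff.1 hV).2
  rw [hd, det_diagonal, Fin.prod_univ_four] at hdet
  have a33 : V 3 3 = 1 := by simpa using hdet
  rw [hd, a33, ← diagonal_one]
  congr 1
  ext i
  fin_cases i <;> rfl

/-- Six Givens steps clear the entries below the diagonal, each column from the bottom up; the last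
step in each of the first three columns also makes the pivot real and nonnegative. Cleared columns
survive because a step on two rows that vanish in a column leaves zeros there. What remains is the
identity. -/
theorem mem_spinImage₆_of_mem_SU {U : Matrix (Fin 4) (Fin 4) ℂ} (hU : U ∈ SU 4) :
    U ∈ spinImage₆ := by
  obtain ⟨A, hA, iA, -, zA, -, -⟩ := exists_eliminate hU 2 0
  obtain ⟨B, hB, iB, -, zB, -, uB⟩ := exists_eliminate hA 1 0
  obtain ⟨C, hC, iC, rC, zC, -, uC⟩ := exists_eliminate hB 0 0
  obtain ⟨D, hD, iD, -, zD, cD, uD⟩ := exists_eliminate hC 2 1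
  obtain ⟨E, hE, iE, rE, zE, cE, uE⟩ := exists_eliminate hD 1 1
  obtain ⟨F, hF, iF, rF, zF, cF, uF⟩ := exists_eliminate hE 2 2
  have B30 : B 3 0 = 0 := (uB 3 0 (by decide) (by decide)).trans zA
  have C20 : C 2 0 = 0 := (uC 2 0 (by decide) (by decide)).trans zB
  have C30 : C 3 0 = 0 := (uC 3 0 (by decide) (by decide)).trans B30
  have D0 := cD 0 C20 C30
  have D10 : D 1 0 = 0 := (uD 1 0 (by decide) (by decide)).trans zC
  have E0 := cE 0 D10 D0.1
  have E30 : E 3 0 = 0 := (uE 3 0 (by decide) (by decide)).trans D0.2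
  have E31 : E 3 1 = 0 := (uE 3 1 (by decide) (by decide)).trans zD
  have F0 := cF 0 E0.2 E30
  have F1 := cF 1 zE E31
  have F10 : F 1 0 = 0 := (uF 1 0 (by decide) (by decide)).trans E0.1
  have F11 : F 1 1 = E 1 1 := uF 1 1 (by decide) (by decide)
  have F00 : F 0 0 = C 0 0 := ((uF 0 0 (by decide) (by decide)).trans
    (uE 0 0 (by decide) (by decide))).trans (uD 0 0 (by decide) (by decide))
  refine iA (iB (iC (iD (iE (iF ?_)))))
  rw [eq_one_of_upperTriangular hF F10 F0.1 F0.2 F1.1 F1.2 zF (F00 ▸ rC) (F11 ▸ rE) rF]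
  exact one_mem _

/-! ### The real span of `SU(n)` -/

section

open scoped Matrix.Norms.L2Operator

/-- As `i^n = 1`, multiplication by `i` preserves `SU(n)`, so its real span is a complex subspace. A
unitary `U` is `z` times the element `z̄ U` of `SU(n)`, where `z^n = det U`, and the unitaries span
the matrices as a C*-algebra for the L² operator norm. -/
theorem span_SU {n : ℕ} [NeZero n] (hI : Complex.I ^ n = 1) :
    Submodule.span ℝ (SU n : Set (Matrix (Fin n) (Fin n) ℂ)) = ⊤ := by
  have key : ∀ (z : ℂ), ∀ M ∈ Submodule.span ℝ (SU n : Set (Matrix (Fin n) (Fin n) ℂ)),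
      z • M ∈ Submodule.span ℝ (SU n : Set (Matrix (Fin n) (Fin n) ℂ)) := by
    have hImul : ∀ M ∈ Submodule.span ℝ (SU n : Set (Matrix (Fin n) (Fin n) ℂ)),
        Complex.I • M ∈ Submodule.span ℝ (SU n : Set (Matrix (Fin n) (Fin n) ℂ)) := by
      intro M hM
      induction hM using Submodule.span_induction with
      | mem M hM =>
        refine Submodule.subset_span (mem_specialUnitaryGroup_iff.2 ⟨?_, ?_⟩)
        · rw [Unitary.mem_iff, StarModule.star_smul, smul_mul_smul_comm, smul_mul_smul_comm,
            (Unitary.mem_iff.1 hM.1).1, (Unitary.mem_iff.1 hM.1).2]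
          simp
        · rw [det_smul, Fintype.card_fin, hI, one_mul]
          exact hM.2
      | zero => rw [smul_zero]; exact zero_mem _
      | add M N _ _ hM hN => rw [smul_add]; exact add_mem hM hN
      | smul t M _ hM => rw [smul_comm]; exact Submodule.smul_mem _ _ hM
    intro z M hM
    rw [← Complex.re_add_im z, add_smul, mul_smul, Complex.coe_smul, Complex.coe_smul]
    exact add_mem (Submodule.smul_mem _ _ hM) (Submodule.smul_mem _ _ (hImul M hM))
  rw [eq_top_iff]
  intro M _
  have hM : M ∈ Submodule.span ℂ (unitary (Matrix (Fin n) (Fin n) ℂ) : Set _) := by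
    rw [CStarAlgebra.span_unitary]
    trivial
  induction hM using Submodule.span_induction with
  | mem U hU =>
    have hdet : ‖U.det‖ = 1 := by
      have h := congrArg det (Unitary.mem_iff.1 hU).1
      rw [det_mul, star_eq_conjTranspose, det_conjTranspose, det_one, Complex.star_def,
        Complex.conj_mul'] at h
      have h1 : ‖U.det‖ ^ 2 = 1 := by exact_mod_cast h
      exact (pow_eq_one_iff_of_nonneg (norm_nonneg _) two_ne_zero).1 h1
    obtain ⟨z, hz⟩ := IsAlgClosed.exists_pow_nat_eq U.det (NeZero.pos n)
    have hz1 : ‖z‖ = 1 := by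
      rw [← hz, norm_pow] at hdet
      exact (pow_eq_one_iff_of_nonneg (norm_nonneg _) (NeZero.ne n)).1 hdet
    have hzz : star z * z = 1 := by
      rw [Complex.star_def, Complex.conj_mul', hz1]
      simp
    have hs : star z • U ∈ SU n := by
      refine mem_specialUnitaryGroup_iff.2 ⟨?_, ?_⟩
      · rw [Unitary.mem_iff, StarModule.star_smul, smul_mul_smul_comm, smul_mul_smul_comm,
          (Unitary.mem_iff.1 hU).1, (Unitary.mem_iff.1 hU).2, star_star, hzz, mul_comm, hzz]
        simp
      · rw [det_smul, Fintype.card_fin, ← hz, ← mul_pow, hzz, one_pow]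
    have h := key z _ (Submodule.subset_span hs)
    rwa [smul_smul, mul_comm, hzz, one_smul] at h
  | zero => exact zero_mem _
  | add M N _ _ hM hN => exact add_mem (hM trivial) (hN trivial)
  | smul z M _ hM => exact key z M (hM trivial)

end

end SpinGroups

open SpinGroups in
theorem mainTheorem10 :
    -- `Spin(6)`, `SU(4)`, `Spin(5)`, `Sp(2)` are embedded Lie groups
    Nonempty (EmbeddedLieGroup (Subtype.val : Spin 6 → CliffordAlgebra (negForm 6))) ∧
    Nonempty (EmbeddedLieGroup (Subtype.val : SU 4 → Matrix (Fin 4) (Fin 4) ℂ)) ∧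
    Nonempty (EmbeddedLieGroup (Subtype.val : Spin 5 → CliffordAlgebra (negForm 5))) ∧
    Nonempty (EmbeddedLieGroup (Subtype.val : Sp 2 → Matrix (Fin 2) (Fin 2) ℍ)) ∧
    -- `Δ⁺` is, after the choice of a complex basis, a Lie group isomorphism onto `SU(4)`
    (∃ (T : evenSpinors 3 ≃ₗ[ℂ] (Fin 4 → ℂ)) (f : Spin 6 ≃* SU 4),
      (∀ (g : Spin 6) (s : evenSpinors 3),
        T (halfSpinRepPlus 3 g s) = (f g : Matrix (Fin 4) (Fin 4) ℂ).mulVec (T s)) ∧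
      ∀ (S : EmbeddedLieGroup (Subtype.val : Spin 6 → CliffordAlgebra (negForm 6)))
        (S' : EmbeddedLieGroup (Subtype.val : SU 4 → Matrix (Fin 4) (Fin 4) ℂ)),
        IsLieGroupIso S S' f) ∧
    -- `Δ` is, after an identification with `ℍ²` as a (right) complex vector space,
    -- a Lie group isomorphism onto `Sp(2)`
    (∃ (T : Spinors 2 ≃+ (Fin 2 → ℍ)) (f : Spin 5 ≃* Sp 2),
      (∀ (z : ℂ) (s : Spinors 2) (j : Fin 2), T (z • s) j = T s j * (z : ℍ)) ∧
      (∀ (g : Spin 5) (s : Spinors 2),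
        T (spinRep 2 g s) = (f g : Matrix (Fin 2) (Fin 2) ℍ).mulVec (T s)) ∧
      ∀ (S : EmbeddedLieGroup (Subtype.val : Spin 5 → CliffordAlgebra (negForm 5)))
        (S' : EmbeddedLieGroup (Subtype.val : Sp 2 → Matrix (Fin 2) (Fin 2) ℍ)),
        IsLieGroupIso S S' f) := by
  obtain ⟨f₆, L₆, hf₆, hL₆, hfL₆⟩ := weylPair.exists_mulEquiv (SU 4) finrank_complexMatrix
    spinHom_weylPair_mem_SU (fun _ => mem_spinImage₆_of_mem_SU)
    (span_SU (by rw [Complex.I_pow_four]))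
  obtain ⟨f₅, L₅, hf₅, hL₅, hfL₅⟩ := quaternionicPair.exists_mulEquiv (Sp 2)
    finrank_quaternionMatrix (fun g => spinImage₅_le_Sp ⟨g, rfl⟩)
    (fun _ => mem_spinImage₅_of_mem_Sp) span_Sp
  -- The spin groups take their manifold structure from the matrix groups, placed in the Clifford
  -- algebra by `L₆` and `L₅`; the matrix groups themselves use the identity map.
  refine ⟨nonempty_embeddedLieGroup_of_SU f₆ L₆ hL₆ fun g => (hfL₆ g).symm,
    nonempty_embeddedLieGroup_of_SU (MulEquiv.refl _) LinearMap.id Function.injective_id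
      fun _ => rfl,
    nonempty_embeddedLieGroup_of_Sp f₅ L₅ hL₅ fun g => (hfL₅ g).symm,
    nonempty_embeddedLieGroup_of_Sp (MulEquiv.refl _) LinearMap.id Function.injective_id
      fun _ => rfl,
    ⟨evenSpinorEquiv.symm, f₆, fun g s => ?_, fun S S' => ?_⟩,
    ⟨quaternionSpinor.symm.toAddEquiv, f₅, fun z s j => ?_, fun g s => ?_, fun S S' => ?_⟩⟩
  · obtain ⟨c, rfl⟩ := evenSpinorEquiv.surjective s
    rw [halfSpinRepPlus_evenSpinorEquiv, LinearEquiv.symm_apply_apply,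
      LinearEquiv.symm_apply_apply, hf₆]
  -- `f₆` is the restriction of the linear map `weylPair.half` and its inverse that of `L₆`, so both
  -- are smooth for arbitrary embedded structures.
  · refine ⟨contMDiff_of_linearMap S S' f₆ weylPair.half hf₆,
      contMDiff_of_linearMap S' S f₆.symm L₆ fun u => ?_⟩
    rw [← hfL₆, MulEquiv.apply_symm_apply]
  · obtain ⟨h, rfl⟩ := quaternionSpinor.surjective s
    change quaternionSpinor.symm _ j = quaternionSpinor.symm _ j * _
    rw [← quaternionSpinor_smul, LinearEquiv.symm_apply_apply, LinearEquiv.symm_apply_apply]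
  · obtain ⟨h, rfl⟩ := quaternionSpinor.surjective s
    change quaternionSpinor.symm _ = Matrix.mulVec _ (quaternionSpinor.symm _)
    rw [half_quaternionSpinor, LinearEquiv.symm_apply_apply, LinearEquiv.symm_apply_apply, hf₅]
  · refine ⟨contMDiff_of_linearMap S S' f₅ quaternionicPair.half hf₅,
      contMDiff_of_linearMap S' S f₅.symm L₅ fun u => ?_⟩
    rw [← hfL₅, MulEquiv.apply_symm_apply]
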